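/- Let $d\ge 1$ and $\rho>0$. Let $\mathsf G=(G_{ijkl})$ be the relaxation modulus of a viscoelastic solid: a function on $]0,\infty[$ whose values are symmetric operators on the space $S$ of real symmetric $d\times d$ matrices (that is, $G_{ijkl}=G_{jikl}=G_{ijlk}=G_{klij}$), such that - for every $E\in S$ the function $s\mapsto E_{ij}G_{ijkl}(s)E_{kl}$ is completely monotonic, i.e. it is $C^\infty$ and its $m$-th derivative times $(-1)^m$ is non-negative for every $m\ge 0$; - $\mathsf G$ has a finite limit at $0+$; - $\mathsf G^\infty:=\lim_{s\to\infty}\mathsf G(s)$ is a positive definite operator on $S$. Let $\mathbf n\in\mathbb R^d$ be a unit vector. For $\operatorname{Re}p>0$ let $$Q_{ijkl}(p)=p\int_0^\infty e^{-pt}G_{ijkl}(t)\,dt,\qquad (\mathbf Q_{\mathbf n}(p))_{ik}=Q_{ijkl}(p)\,n_jn_l,\qquad \mathbf K_{\mathbf n}(p)=\rho^{1/2}\,p\,\mathbf Q_{\mathbf n}(p)^{-1/2},$$ with the principal square root (the square root all of whose eigenvalues lie in the open right half-plane). Fix $\sigma>0$ and let $$\mathbf G_2(t,y)=\frac{\mathrm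 i^{\,d-1}}{2(2\pi)^d}\lim_{R\to\infty}\int_{\sigma-\mathrm iR}^{\sigma+\mathrm iR}e^{pt}\,\mathbf Q_{\mathbf n}(p)^{-1}\mathbf K_{\mathbf n}(p)^{-1}e^{-|y|\mathbf K_{\mathbf n}(p)}\,dp,\qquad \mathbf G_1(t,y)=\Big(-\frac{\partial}{\partial y}\Big)^{d-1}\mathbf G_2(t,y).$$ For odd $d$, the functions $\mathbf G_1(t,\mathbf n\cdot\mathbf x)$ are the plane-wave components of the viscoelastic Green's function. **Theorem.** The limit $\mathbf B_{\mathbf n}=\lim_{p\to+\infty}p^{-1}\mathbf K_{\mathbf n}(p)$ (over real $p$) exists and is a real symmetric positive definite matrix. Let $b^0(\mathbf n)>0$ be its smallest eigenvalue. For all $t\in\mathbb R$ and $\mathbf x\in\mathbb R^d$ with $t<b^0(\mathbf n)\,|\mathbf n\cdot\mathbf x|$, the integral that defines $\mathbf G_2(t,\mathbf n\cdot\mathbf x)$ converges, $\mathbf G_2(t,\cdot)$ is $C^\infty$ at $\mathbf n\cdot\mathbf x$, and $$\mathbf G_1(t,\mathbf n\cdot\mathbf x)=0 .$$ Consequently $1/b^0(\mathbf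 n)$ is an upper bound for the propagation speed: if $\mathbf G_1(t,y)\neq 0$, then $|y|\le t/b^0(\mathbf n)$. -/

import Mathlib

open Filter Topology MeasureTheory
open scoped ContDiff

namespace Viscoelastic

/-- Rank-4 tensors on `ℝ^d` in a fixed orthonormal coordinate system. -/
abbrev Tensor4 (d : ℕ) : Type := Fin d → Fin d → Fin d → Fin d → ℝ

/-- The components `H i j k l` describe a symmetric operator `(H E)_ij = ∑ H_ijkl E_kl` on the
space of symmetric `d × d` matrices: minor symmetries and major symmetry. -/
structure IsSymmetricOperator {d : ℕ} (H : Tensor4 d) : Prop where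
  minor_left : ∀ i j k l, H i j k l = H j i k l
  minor_right : ∀ i j k l, H i j k l = H i j l k
  major : ∀ i j k l, H i j k l = H k l i j

/-- The quadratic form `⟨E, H E⟩ = E_ij H_ijkl E_kl`. -/
def quadForm {d : ℕ} (H : Tensor4 d) (E : Matrix (Fin d) (Fin d) ℝ) : ℝ :=
  ∑ i, ∑ j, ∑ k, ∑ l, E i j * H i j k l * E k l

/-- Positive definiteness on the space of symmetric matrices. -/
def PositiveDefinite {d : ℕ} (H : Tensor4 d) : Prop :=
  ∀ E : Matrix (Fin d) (Fin d) ℝ, E.IsSymm → E ≠ 0 → 0 < quadForm H E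

/-- Completely monotonic functions on `]0, ∞[`. -/
def CompletelyMonotonic (f : ℝ → ℝ) : Prop :=
  ContDiffOn ℝ ∞ f (Set.Ioi 0) ∧
    ∀ m : ℕ, ∀ s : ℝ, 0 < s → 0 ≤ (-1) ^ m * iteratedDeriv m f s

/-- Relaxation modulus of a viscoelastic solid: a completely monotonic function on `]0, ∞[` with
values in the symmetric operators on the space of symmetric matrices, with a finite limit at `0`
and a positive definite limit at `∞`. (The values at `s ≤ 0` are never used.) -/
structure IsRelaxationModulus {d : ℕ} (G : ℝ → Tensor4 d) : Prop where
  symmetric : ∀ s : ℝ, 0 < s → IsSymmetricOperator (G s)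
  completelyMonotonic : ∀ E : Matrix (Fin d) (Fin d) ℝ, E.IsSymm →
    CompletelyMonotonic (fun s => quadForm (G s) E)
  finite_limit : ∃ G₀ : Tensor4 d, Tendsto G (𝓝[>] 0) (𝓝 G₀)
  solid : ∃ G_inf : Tensor4 d, Tendsto G atTop (𝓝 G_inf) ∧ PositiveDefinite G_inf

noncomputable section

/-- `Q(p) = p ∫₀^∞ e^{-pt} G(t) dt`, componentwise. -/
def Q {d : ℕ} (G : ℝ → Tensor4 d) (p : ℂ) (i j k l : Fin d) : ℂ :=
  p * ∫ t in Set.Ioi (0 : ℝ), Complex.exp (-p * (t : ℂ)) * (G t i j k l : ℂ)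

/-- `(Q_n(p))_ik = Q_ijkl(p) n_j n_l`. -/
def Qn {d : ℕ} (G : ℝ → Tensor4 d) (n : EuclideanSpace ℝ (Fin d)) (p : ℂ) :
    Matrix (Fin d) (Fin d) ℂ :=
  Matrix.of fun i k => ∑ j, ∑ l, Q G p i j k l * (n j : ℂ) * (n l : ℂ)

/-- `Y` is a principal square root of `A`: `Y² = A` and all eigenvalues of `Y` lie in the open
right half-plane. -/
def IsPrincipalSqrt {d : ℕ} (A Y : Matrix (Fin d) (Fin d) ℂ) : Prop :=
  Y * Y = A ∧ ∀ z ∈ spectrum ℂ Y, 0 < z.re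

open Classical in
/-- The principal square root; it exists and is unique when `A` has no eigenvalue in `]-∞, 0]`
(and is set to `0` if there is none). -/
def principalSqrt {d : ℕ} (A : Matrix (Fin d) (Fin d) ℂ) : Matrix (Fin d) (Fin d) ℂ :=
  if h : ∃ Y, IsPrincipalSqrt A Y then h.choose else 0

/-- `K_n(p) = ρ^{1/2} p Q_n(p)^{-1/2}`. -/
def Kn {d : ℕ} (ρ : ℝ) (G : ℝ → Tensor4 d) (n : EuclideanSpace ℝ (Fin d)) (p : ℂ) :
    Matrix (Fin d) (Fin d) ℂ :=
  ((Real.sqrt ρ : ℂ) * p) • (principalSqrt (Qn G n p))⁻¹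

/-- The integral of `f` over the segment `[σ - iR, σ + iR]`. -/
def segmentIntegral (σ : ℝ) (f : ℂ → ℂ) (R : ℝ) : ℂ :=
  ∫ τ in (-R)..R, f ((σ : ℂ) + (τ : ℂ) * Complex.I) * Complex.I

/-- Convergence of the (improper) Bromwich integral over the line `Re p = σ`. -/
def BromwichConverges (σ : ℝ) (f : ℂ → ℂ) : Prop :=
  (∀ R : ℝ, IntervalIntegrable (fun τ : ℝ => f ((σ : ℂ) + (τ : ℂ) * Complex.I)) volume (-R) R) ∧
    ∃ L : ℂ, Tendsto (segmentIntegral σ f) atTop (𝓝 L)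

/-- The (improper) Bromwich integral `lim_{R → ∞} ∫_{σ-iR}^{σ+iR} f(p) dp`. -/
def bromwichIntegral (σ : ℝ) (f : ℂ → ℂ) : ℂ :=
  limUnder atTop (segmentIntegral σ f)

/-- The integrand `e^{pt} Q_n(p)⁻¹ K_n(p)⁻¹ e^{-|y| K_n(p)}`. -/
def planeWaveIntegrand {d : ℕ} (ρ : ℝ) (G : ℝ → Tensor4 d) (n : EuclideanSpace ℝ (Fin d))
    (t y : ℝ) (p : ℂ) : Matrix (Fin d) (Fin d) ℂ :=
  Complex.exp (p * (t : ℂ)) •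
    ((Qn G n p)⁻¹ * (Kn ρ G n p)⁻¹ * NormedSpace.exp ((-(|y| : ℝ) : ℂ) • Kn ρ G n p))

/-- `G₂(t, y)`, entrywise. -/
def G₂ {d : ℕ} (ρ : ℝ) (G : ℝ → Tensor4 d) (n : EuclideanSpace ℝ (Fin d)) (σ t y : ℝ) :
    Matrix (Fin d) (Fin d) ℂ :=
  Matrix.of fun i k =>
    Complex.I ^ (d - 1) / (2 * (2 * (Real.pi : ℂ)) ^ d) *
      bromwichIntegral σ (fun p => planeWaveIntegrand ρ G n t y p i k)

/-- The plane wave `G₁(t, y) = (-∂/∂y)^{d-1} G₂(t, y)`, entrywise. -/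
def G₁ {d : ℕ} (ρ : ℝ) (G : ℝ → Tensor4 d) (n : EuclideanSpace ℝ (Fin d)) (σ t y : ℝ) :
    Matrix (Fin d) (Fin d) ℂ :=
  Matrix.of fun i k =>
    (-1) ^ (d - 1) * iteratedDeriv (d - 1) (fun z : ℝ => G₂ ρ G n σ t z i k) y

end

end Viscoelastic

/-!
The integral that defines `G₂` is shown to vanish on the open set `t < b₀ |y|`, by closing the
Bromwich contour to the right. This needs two facts: for `Re p > 0` the integrand is holomorphic,
and it is bounded by `C e^{-(b₀ |y| - t) Re p} / |p|` (`tendsto_segmentIntegral_zero`,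
`IsRelaxationModulus.planeWave_bromwich`). Smoothness of `G₂(t, ·)` and the vanishing
of `G₁` follow, as the set is open in `y`.

The inverse square root is represented by the resolvent integral
`A^{-1/2} = π⁻¹ ∫ (s² + A)⁻¹ ds`, taken over the real line, for matrices `A` whose numerical range
lies in a half-plane `Re z ≥ c > 0`. The integral is differentiable in `A`
(`Coercive.hasFDerivAt_invSqrt`), bounded in terms of `c` only, and squares to `A⁻¹`
(`Coercive.invSqrt_mul_self_mul`): along the segment from `1` to `A` the derivative of
`(A^{-1/2})² A` is zero by an integration by parts. Together with uniqueness of principal square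
roots (`IsPrincipalSqrt.unique`) this identifies `K_n(p)` with `ρ^{1/2} p Q_n(p)^{-1/2}` in this
sense.

Complete monotonicity enters through two properties of the scalar functions
`f(s) = ⟨u ⊗ n, G(s) u ⊗ n⟩`, whose Laplace transforms give the form of `Q_n(p)`:
`Re (p f̂(p)) ≥ f(∞)`, which makes `Q_n(p)` coercive, and `Re f̂(p) ≥ 0`, which holds because `f` is
decreasing and convex. The second one makes each `p (s² + Q_n(p))⁻¹` accretive, since its inverse
`s² / p + Q_n(p) / p` is, and hence `K_n(p)` is accretive.

Finally, `⟨v, K_n(p) v⟩` is a holomorphic function with non-negative real part on the right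
half-plane, and `x⁻¹ ⟨v, K_n(x) v⟩` tends to `⟨v, B v⟩` as `x → +∞`. Julia's lemma
(`julia_halfPlane`) upgrades this to `Re ⟨v, K_n(p) v⟩ ≥ Re p ⟨v, B v⟩ ≥ b₀ Re p |v|²`
(`IsRelaxationModulus.coercive_Kn`), and so `‖e^{-|y| K_n(p)}‖ ≤ e^{-b₀ |y| Re p}`
(`Coercive.norm_exp_le`).
-/

namespace Viscoelastic

open scoped Matrix.Norms.L2Operator
open Matrix

section Root

variable {ι : Type*} [Fintype ι] [DecidableEq ι]

/-! ### Numerical range and coercivity -/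

/-- The value `⟨v, A v⟩` of the sesquilinear form of `A`, as a continuous linear functional
of `A`. -/
noncomputable def numForm (v : EuclideanSpace ℂ ι) : Matrix ι ι ℂ →L[ℂ] ℂ :=
  LinearMap.toContinuousLinearMap
    { toFun := fun A => inner ℂ v (toEuclideanCLM (n := ι) (𝕜 := ℂ) A v)
      map_add' := fun A B => by simp
      map_smul' := fun c A => by simp }

lemma numForm_apply (v : EuclideanSpace ℂ ι) (A : Matrix ι ι ℂ) :
    numForm v A = inner ℂ v (toEuclideanCLM (n := ι) (𝕜 := ℂ) A v) := rfl

lemma numForm_one (v : EuclideanSpace ℂ ι) : numForm v 1 = (‖v‖ : ℂ) ^ 2 := by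
  rw [numForm_apply, map_one]
  exact inner_self_eq_norm_sq_to_K v

lemma norm_numForm_le (v : EuclideanSpace ℂ ι) (A : Matrix ι ι ℂ) :
    ‖numForm v A‖ ≤ ‖A‖ * ‖v‖ ^ 2 := by
  rw [numForm_apply]
  calc _ ≤ ‖v‖ * ‖toEuclideanCLM (n := ι) (𝕜 := ℂ) A v‖ := norm_inner_le_norm _ _
    _ ≤ ‖v‖ * (‖A‖ * ‖v‖) := by
      gcongr
      exact (toEuclideanCLM (n := ι) (𝕜 := ℂ) A).le_opNorm v
    _ = _ := by ring

/-- The real part of the numerical range of `A` is at least `c`. -/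
def Coercive (c : ℝ) (A : Matrix ι ι ℂ) : Prop :=
  ∀ v : EuclideanSpace ℂ ι, c * ‖v‖ ^ 2 ≤ (numForm v A).re

lemma Coercive.mul_norm_le {c : ℝ} {A : Matrix ι ι ℂ} (h : Coercive c A)
    (v : EuclideanSpace ℂ ι) : c * ‖v‖ ≤ ‖toEuclideanCLM (n := ι) (𝕜 := ℂ) A v‖ := by
  rcases (norm_nonneg v).eq_or_lt with h0 | h0
  · simp [← h0]
  · have h1 : c * ‖v‖ ^ 2 ≤ ‖v‖ * ‖toEuclideanCLM (n := ι) (𝕜 := ℂ) A v‖ :=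
      ((h v).trans (Complex.re_le_norm _)).trans (norm_inner_le_norm (𝕜 := ℂ) v _)
    nlinarith

lemma Coercive.isUnit {c : ℝ} (hc : 0 < c) {A : Matrix ι ι ℂ} (h : Coercive c A) : IsUnit A := by
  rw [← mulVec_injective_iff_isUnit]
  refine (injective_iff_map_eq_zero (mulVecLin A)).2 fun v hv => ?_
  have h1 := h.mul_norm_le (WithLp.toLp 2 v)
  rw [toEuclideanCLM_toLp] at h1
  have h2 : A *ᵥ v = 0 := hv
  rw [h2] at h1
  have h3 : ‖WithLp.toLp 2 v‖ ≤ 0 := by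
    have : ‖(WithLp.toLp 2 (0 : ι → ℂ))‖ = 0 := by simp
    rw [this] at h1
    nlinarith [norm_nonneg (WithLp.toLp 2 v)]
  simpa using h3

lemma Coercive.isUnit_det {c : ℝ} (hc : 0 < c) {A : Matrix ι ι ℂ} (h : Coercive c A) :
    IsUnit A.det := (isUnit_iff_isUnit_det A).1 (h.isUnit hc)

lemma toEuclideanCLM_mul_apply (A B : Matrix ι ι ℂ) (v : EuclideanSpace ℂ ι) :
    toEuclideanCLM (n := ι) (𝕜 := ℂ) (A * B) v =
      toEuclideanCLM (n := ι) (𝕜 := ℂ) A (toEuclideanCLM (n := ι) (𝕜 := ℂ) B v) := by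
  rw [map_mul]; rfl

lemma Coercive.norm_inv_le {c : ℝ} (hc : 0 < c) {A : Matrix ι ι ℂ} (h : Coercive c A) :
    ‖A⁻¹‖ ≤ c⁻¹ := by
  rw [← l2_opNorm_toEuclideanCLM]
  refine ContinuousLinearMap.opNorm_le_bound _ (by positivity) fun v => ?_
  have h1 := h.mul_norm_le (toEuclideanCLM (n := ι) (𝕜 := ℂ) A⁻¹ v)
  rw [← toEuclideanCLM_mul_apply, mul_nonsing_inv _ (h.isUnit_det hc), map_one] at h1
  rw [inv_mul_eq_div, le_div_iff₀' hc]
  exact h1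

/-- With `u = A⁻¹ v`, the form of `A⁻¹` at `v` is the conjugate of the form of `A` at `u`. -/
lemma numForm_inv {A : Matrix ι ι ℂ} (h : IsUnit A.det) (v : EuclideanSpace ℂ ι) :
    numForm v A⁻¹ = (starRingEnd ℂ) (numForm (toEuclideanCLM (n := ι) (𝕜 := ℂ) A⁻¹ v) A) := by
  rw [numForm_apply, numForm_apply, ← toEuclideanCLM_mul_apply, mul_nonsing_inv _ h, map_one,
    inner_conj_symm]
  rfl

/-- An eigenvalue of `A` is a value of the form of `A` at a nonzero vector, up to a positive
factor. -/
lemma exists_re_numForm_eq_of_mem_spectrum {A : Matrix ι ι ℂ} {z : ℂ} (hz : z ∈ spectrum ℂ A) :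
    ∃ v : EuclideanSpace ℂ ι, v ≠ 0 ∧ (numForm v A).re = z.re * ‖v‖ ^ 2 := by
  have h1 : Module.End.HasEigenvalue (toLin' A) z := by
    rw [Module.End.hasEigenvalue_iff_mem_spectrum, spectrum_toLin']
    exact hz
  obtain ⟨v, hv⟩ := h1.exists_hasEigenvector
  refine ⟨WithLp.toLp 2 v, by simpa using hv.2, ?_⟩
  have h3 : A *ᵥ v = z • v := by simpa using hv.apply_eq_smul
  rw [numForm_apply, toEuclideanCLM_toLp, h3, WithLp.toLp_smul, inner_smul_right,
    inner_self_eq_norm_sq_to_K, ← RCLike.ofReal_pow]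
  exact Complex.re_mul_ofReal _ _

lemma re_spectrum_pos_of_numForm_pos {A : Matrix ι ι ℂ}
    (h : ∀ v : EuclideanSpace ℂ ι, v ≠ 0 → 0 < (numForm v A).re) {z : ℂ} (hz : z ∈ spectrum ℂ A) :
    0 < z.re := by
  obtain ⟨v, hv, hvz⟩ := exists_re_numForm_eq_of_mem_spectrum hz
  exact pos_of_mul_pos_left (hvz ▸ h v hv) (by positivity)

lemma re_spectrum_nonneg_of_numForm_nonneg {A : Matrix ι ι ℂ}
    (h : ∀ v : EuclideanSpace ℂ ι, 0 ≤ (numForm v A).re) {z : ℂ} (hz : z ∈ spectrum ℂ A) :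
    0 ≤ z.re := by
  obtain ⟨v, hv, hvz⟩ := exists_re_numForm_eq_of_mem_spectrum hz
  exact nonneg_of_mul_nonneg_left (hvz ▸ h v) (by positivity)

/-! ### Uniqueness of the principal square root -/

/-- Sylvester's theorem in the form needed: if `Y X = X W` and the spectra of `Y` and `W` are
disjoint, then `X = 0`. -/
lemma eq_zero_of_intertwining {Y W X : Matrix ι ι ℂ} (h : Y * X = X * W)
    (hd : ∀ z ∈ spectrum ℂ W, z ∉ spectrum ℂ Y) : X = 0 := by
  have key : ∀ p : Polynomial ℂ, Polynomial.aeval Y p * X = X * Polynomial.aeval W p := by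
    intro p
    induction p using Polynomial.induction_on' with
    | add p q hp hq => simp [add_mul, mul_add, hp, hq]
    | monomial n a =>
      have hn : Y ^ n * X = X * W ^ n :=
        (SemiconjBy.pow_right (show SemiconjBy X W Y from h.symm) n).symm
      simp [Polynomial.aeval_monomial, Algebra.algebraMap_eq_smul_one, hn]
  have h1 := key Y.charpoly
  rw [aeval_self_charpoly, zero_mul] at h1
  have h2 : IsUnit (Polynomial.aeval W Y.charpoly) := by
    rcases isEmpty_or_nonempty ι with he | he
    · exact isUnit_of_subsingleton _
    rw [← spectrum.zero_notMem_iff ℂ, spectrum.map_polynomial_aeval]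
    rintro ⟨z, hz, h0⟩
    exact hd z hz (mem_spectrum_iff_isRoot_charpoly.2 h0)
  exact (h2.mul_left_eq_zero).1 h1.symm

lemma IsPrincipalSqrt.unique {d : ℕ} {A Y Z : Matrix (Fin d) (Fin d) ℂ}
    (hY : IsPrincipalSqrt A Y) (hZ : IsPrincipalSqrt A Z) : Y = Z := by
  rw [← sub_eq_zero]
  refine eq_zero_of_intertwining (Y := Y) (W := -Z) ?_ fun z hz hz' => ?_
  · rw [mul_sub, sub_mul, mul_neg, mul_neg, hY.1, hZ.1]; abel
  · rw [← spectrum.neg_eq, Set.mem_neg] at hz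
    have h1 := hZ.2 _ hz
    have h2 := hY.2 _ hz'
    rw [Complex.neg_re] at h1
    linarith

lemma principalSqrt_eq {d : ℕ} {A Y : Matrix (Fin d) (Fin d) ℂ} (hY : IsPrincipalSqrt A Y) :
    principalSqrt A = Y := by
  have h : ∃ Y, IsPrincipalSqrt A Y := ⟨Y, hY⟩
  rw [principalSqrt, dif_pos h]
  exact h.choose_spec.unique hY

/-! ### The inverse square root as a resolvent integral -/

/-- The resolvent `(s² + A)⁻¹`. -/
noncomputable def sqResolvent (A : Matrix ι ι ℂ) (s : ℝ) : Matrix ι ι ℂ :=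
  (((s ^ 2 : ℝ) : ℂ) • (1 : Matrix ι ι ℂ) + A)⁻¹

/-- The inverse principal square root `A^{-1/2} = π⁻¹ ∫ (s² + A)⁻¹ ds` of a coercive matrix. -/
noncomputable def invSqrt (A : Matrix ι ι ℂ) : Matrix ι ι ℂ :=
  (Real.pi : ℂ)⁻¹ • ∫ s : ℝ, sqResolvent A s

lemma Coercive.shift {c : ℝ} {A : Matrix ι ι ℂ} (h : Coercive c A) (s : ℝ) :
    Coercive (s ^ 2 + c) (((s ^ 2 : ℝ) : ℂ) • (1 : Matrix ι ι ℂ) + A) := by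
  intro v
  have h1 : (numForm v (((s ^ 2 : ℝ) : ℂ) • (1 : Matrix ι ι ℂ) + A)).re
      = s ^ 2 * ‖v‖ ^ 2 + (numForm v A).re := by
    rw [map_add, map_smul, numForm_one, smul_eq_mul, Complex.add_re, Complex.re_ofReal_mul,
      ← Complex.ofReal_pow, Complex.ofReal_re]
  rw [h1, add_mul]
  linarith [h v]

lemma Coercive.perturb {c : ℝ} {A B : Matrix ι ι ℂ} (h : Coercive c A) {δ : ℝ}
    (hB : ‖B - A‖ ≤ δ) : Coercive (c - δ) B := by
  intro v
  have h1 : ‖numForm v (B - A)‖ ≤ δ * ‖v‖ ^ 2 := (norm_numForm_le _ _).trans (by gcongr)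
  have h2 := (Complex.abs_re_le_norm _).trans h1
  rw [map_sub, Complex.sub_re, abs_le] at h2
  have := h v
  rw [sub_mul]
  linarith [h2.1]

lemma Coercive.shift_isUnit {c : ℝ} (hc : 0 < c) {A : Matrix ι ι ℂ} (h : Coercive c A) (s : ℝ) :
    IsUnit (((s ^ 2 : ℝ) : ℂ) • (1 : Matrix ι ι ℂ) + A) :=
  (h.shift s).isUnit (by positivity)

lemma Coercive.shift_mul_sqResolvent {c : ℝ} (hc : 0 < c) {A : Matrix ι ι ℂ} (h : Coercive c A)
    (s : ℝ) : (((s ^ 2 : ℝ) : ℂ) • (1 : Matrix ι ι ℂ) + A) * sqResolvent A s = 1 :=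
  mul_nonsing_inv _ ((isUnit_iff_isUnit_det _).1 (h.shift_isUnit hc s))

lemma Coercive.norm_sqResolvent_le {c : ℝ} (hc : 0 < c) {A : Matrix ι ι ℂ} (h : Coercive c A)
    (s : ℝ) : ‖sqResolvent A s‖ ≤ (s ^ 2 + c)⁻¹ :=
  (h.shift s).norm_inv_le (by positivity)

lemma inv_sq_add_le {c : ℝ} (hc : 0 < c) (s : ℝ) :
    (s ^ 2 + c)⁻¹ ≤ (1 + c⁻¹) * (1 + s ^ 2)⁻¹ := by
  rw [← div_eq_mul_inv, inv_le_comm₀ (by positivity) (by positivity), inv_div,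
    div_le_iff₀ (by positivity)]
  have h1 : (s ^ 2 + c) * (1 + c⁻¹) = s ^ 2 + s ^ 2 * c⁻¹ + c + 1 := by field_simp; ring
  rw [h1]
  have : 0 ≤ s ^ 2 * c⁻¹ := by positivity
  linarith

lemma integrable_inv_sq_add {c : ℝ} (hc : 0 < c) : Integrable fun s : ℝ => (s ^ 2 + c)⁻¹ := by
  refine (integrable_inv_one_add_sq.const_mul (1 + c⁻¹)).mono' ?_ (Eventually.of_forall fun s => ?_)
  · exact (Continuous.inv₀ (by fun_prop) fun s => by positivity).aestronglyMeasurable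
  · rw [Real.norm_of_nonneg (by positivity)]
    exact inv_sq_add_le hc s

lemma Coercive.continuous_sqResolvent {c : ℝ} (hc : 0 < c) {A : Matrix ι ι ℂ} (h : Coercive c A) :
    Continuous (sqResolvent A) := by
  have h1 : sqResolvent A = fun s : ℝ =>
      Ring.inverse (((s ^ 2 : ℝ) : ℂ) • (1 : Matrix ι ι ℂ) + A) := by
    funext s
    rw [sqResolvent, nonsing_inv_eq_ringInverse]
  rw [h1, continuous_iff_continuousAt]
  intro s
  refine ContinuousAt.comp (g := Ring.inverse)
    (f := fun s : ℝ => ((s ^ 2 : ℝ) : ℂ) • (1 : Matrix ι ι ℂ) + A) ?_ ?_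
  · exact NormedRing.inverse_continuousAt (h.shift_isUnit hc s).unit
  · have h2 : Continuous fun s : ℝ => ((s ^ 2 : ℝ) : ℂ) := by fun_prop
    exact ((h2.smul continuous_const).add continuous_const).continuousAt

lemma Coercive.integrable_sqResolvent {c : ℝ} (hc : 0 < c) {A : Matrix ι ι ℂ} (h : Coercive c A) :
    Integrable (sqResolvent A) :=
  (integrable_inv_sq_add hc).mono' (h.continuous_sqResolvent hc).aestronglyMeasurable
    (Eventually.of_forall fun s => h.norm_sqResolvent_le hc s)

lemma Coercive.integrable_sqResolvent_sq {c : ℝ} (hc : 0 < c) {A : Matrix ι ι ℂ}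
    (h : Coercive c A) : Integrable fun s => sqResolvent A s * sqResolvent A s := by
  have hcont := h.continuous_sqResolvent hc
  refine ((integrable_inv_sq_add hc).mul_const c⁻¹).mono'
    (hcont.mul hcont).aestronglyMeasurable (Eventually.of_forall fun s => ?_)
  have h1 := h.norm_sqResolvent_le hc s
  have h2 : (s ^ 2 + c)⁻¹ ≤ c⁻¹ := by gcongr; nlinarith
  calc _ ≤ ‖sqResolvent A s‖ * ‖sqResolvent A s‖ := norm_mul_le _ _
    _ ≤ _ := by gcongr; exact h1.trans h2

lemma Coercive.hasFDerivAt_sqResolvent {c : ℝ} (hc : 0 < c) {A : Matrix ι ι ℂ} (h : Coercive c A)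
    (s : ℝ) : HasFDerivAt (fun A => sqResolvent A s)
      (-ContinuousLinearMap.mulLeftRight ℂ (Matrix ι ι ℂ) (sqResolvent A s) (sqResolvent A s))
      A := by
  have h1 := hasFDerivAt_ringInverse (𝕜 := ℂ) (h.shift_isUnit hc s).unit
  have h2 : (((h.shift_isUnit hc s).unit⁻¹ : (Matrix ι ι ℂ)ˣ) : Matrix ι ι ℂ)
      = sqResolvent A s := by
    rw [sqResolvent, nonsing_inv_eq_ringInverse, ← Ring.inverse_unit]
    rfl
  rw [h2] at h1
  have h3 : HasFDerivAt (fun A : Matrix ι ι ℂ => ((s ^ 2 : ℝ) : ℂ) • (1 : Matrix ι ι ℂ) + A)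
      (ContinuousLinearMap.id ℂ _) A := (hasFDerivAt_id A).const_add _
  have h4 := HasFDerivAt.comp A (g := Ring.inverse) h1 h3
  simp only [sqResolvent, nonsing_inv_eq_ringInverse] at h4 ⊢
  exact h4

/-- Differentiation under the integral sign: `A ↦ A^{-1/2}` is differentiable on coercive
matrices. -/
lemma Coercive.hasFDerivAt_invSqrt {c : ℝ} (hc : 0 < c) {A : Matrix ι ι ℂ} (h : Coercive c A) :
    HasFDerivAt (invSqrt (ι := ι)) ((Real.pi : ℂ)⁻¹ • ∫ s : ℝ,
      -ContinuousLinearMap.mulLeftRight ℂ (Matrix ι ι ℂ)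
        (sqResolvent A s) (sqResolvent A s)) A := by
  have hball : ∀ B ∈ Metric.ball A (c / 2), Coercive (c / 2) B := fun B hB => by
    have h1 : ‖B - A‖ ≤ c / 2 := by
      rw [← dist_eq_norm]; exact (Metric.mem_ball.1 hB).le
    have h2 := h.perturb h1
    rwa [sub_half] at h2
  have hc2 : 0 < c / 2 := by positivity
  suffices hs : HasFDerivAt (fun A : Matrix ι ι ℂ => ∫ s : ℝ, sqResolvent A s) (∫ s : ℝ,
      -ContinuousLinearMap.mulLeftRight ℂ (Matrix ι ι ℂ) (sqResolvent A s) (sqResolvent A s)) A from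
    hs.const_smul (Real.pi : ℂ)⁻¹
  refine hasFDerivAt_integral_of_dominated_of_fderiv_le
    (F := fun A s => sqResolvent A s)
    (F' := fun A s => -ContinuousLinearMap.mulLeftRight ℂ (Matrix ι ι ℂ) (sqResolvent A s)
      (sqResolvent A s))
    (bound := fun s => (c / 2)⁻¹ * (s ^ 2 + c / 2)⁻¹)
    (Metric.ball_mem_nhds A hc2) ?_ (h.integrable_sqResolvent hc) ?_ ?_ ?_ ?_
  · filter_upwards [Metric.ball_mem_nhds A hc2] with B hB
    exact ((hball B hB).continuous_sqResolvent hc2).aestronglyMeasurable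
  · have hcont := h.continuous_sqResolvent hc
    refine Continuous.aestronglyMeasurable (Continuous.neg ?_)
    exact ((ContinuousLinearMap.mulLeftRight ℂ (Matrix ι ι ℂ)).continuous.comp
      hcont).clm_apply hcont
  · refine Eventually.of_forall fun s B hB => ?_
    have h1 := (hball B hB).norm_sqResolvent_le hc2 s
    have h2 : (s ^ 2 + c / 2)⁻¹ ≤ (c / 2)⁻¹ := by gcongr; nlinarith
    rw [norm_neg]
    refine (ContinuousLinearMap.opNorm_mulLeftRight_apply_apply_le ℂ (Matrix ι ι ℂ) _ _).trans ?_
    gcongr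
    exact h1.trans h2
  · exact (integrable_inv_sq_add hc2).const_mul _
  · exact Eventually.of_forall fun s B hB => (hball B hB).hasFDerivAt_sqResolvent hc2 s

lemma commute_sqResolvent {A X : Matrix ι ι ℂ} (h : Commute X A) (s : ℝ) :
    Commute X (sqResolvent A s) := by
  rw [sqResolvent, nonsing_inv_eq_ringInverse]
  have h1 : Commute X (((s ^ 2 : ℝ) : ℂ) • (1 : Matrix ι ι ℂ) + A) :=
    ((Commute.one_right X).smul_right _).add_right h
  by_cases hu : IsUnit (((s ^ 2 : ℝ) : ℂ) • (1 : Matrix ι ι ℂ) + A)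
  · obtain ⟨u, hu⟩ := hu
    rw [← hu, Ring.inverse_unit]
    rw [← hu] at h1
    exact h1.units_inv_right
  · rw [Ring.inverse_non_unit _ hu]
    exact Commute.zero_right X

lemma Coercive.hasDerivAt_smul_sqResolvent {c : ℝ} (hc : 0 < c) {A : Matrix ι ι ℂ}
    (h : Coercive c A) (s : ℝ) :
    HasDerivAt (fun s : ℝ => (s : ℂ) • sqResolvent A s)
      ((2 : ℂ) • (A * (sqResolvent A s * sqResolvent A s)) - sqResolvent A s) s := by
  have h1 : HasDerivAt (fun s : ℝ => (s : ℂ)) 1 s := Complex.ofRealCLM.hasDerivAt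
  have h2 : HasDerivAt (fun s : ℝ => ((s ^ 2 : ℝ) : ℂ) • (1 : Matrix ι ι ℂ) + A)
      ((2 * (s : ℂ)) • (1 : Matrix ι ι ℂ)) s := by
    have h3 := ((h1.pow 2).smul_const (1 : Matrix ι ι ℂ)).add_const A
    simpa using h3
  have h4 : HasDerivAt (sqResolvent A)
      (-(sqResolvent A s * ((2 * (s : ℂ)) • (1 : Matrix ι ι ℂ)) * sqResolvent A s)) s := by
    have h5 := (hasFDerivAt_ringInverse (𝕜 := ℂ) (h.shift_isUnit hc s).unit).restrictScalars ℝ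
    have h6 : (((h.shift_isUnit hc s).unit⁻¹ : (Matrix ι ι ℂ)ˣ) : Matrix ι ι ℂ)
        = sqResolvent A s := by
      rw [sqResolvent, nonsing_inv_eq_ringInverse, ← Ring.inverse_unit]
      rfl
    rw [h6] at h5
    have h7 := HasFDerivAt.comp_hasDerivAt s (l := Ring.inverse) h5 h2
    have h8 : sqResolvent A = Ring.inverse ∘
        fun s : ℝ => ((s ^ 2 : ℝ) : ℂ) • (1 : Matrix ι ι ℂ) + A := by
      funext s
      rw [sqResolvent, nonsing_inv_eq_ringInverse]; rfl
    rw [h8]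
    rw [h8] at h7
    exact h7
  have h9 := h1.smul h4
  have h10 := h.shift_mul_sqResolvent hc s
  rw [add_mul, smul_mul_assoc, one_mul] at h10
  have h11 : A * sqResolvent A s = 1 - ((s ^ 2 : ℝ) : ℂ) • sqResolvent A s := by
    rw [← h10]; abel
  have h12 : (2 : ℂ) * ((s ^ 2 : ℝ) : ℂ) = (s : ℂ) * (2 * (s : ℂ)) := by push_cast; ring
  have h13 : (2 : ℂ) • (A * (sqResolvent A s * sqResolvent A s)) - sqResolvent A s =
      (s : ℂ) • -(sqResolvent A s * ((2 * (s : ℂ)) • (1 : Matrix ι ι ℂ)) * sqResolvent A s)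
        + (1 : ℂ) • sqResolvent A s := by
    rw [← mul_assoc, h11]
    simp only [sub_mul, one_mul, smul_mul_assoc, mul_smul_comm, mul_one, smul_sub, smul_neg,
      smul_smul, one_smul]
    rw [h12, two_smul]
    abel
  rw [h13]
  exact h9

lemma Coercive.norm_smul_sqResolvent_le {c : ℝ} (hc : 0 < c) {A : Matrix ι ι ℂ}
    (h : Coercive c A) (s : ℝ) : ‖(s : ℂ) • sqResolvent A s‖ ≤ |s|⁻¹ := by
  rw [norm_smul, Complex.norm_real, Real.norm_eq_abs]
  rcases eq_or_ne s 0 with rfl | hs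
  · simp
  · have h1 : 0 < |s| := abs_pos.2 hs
    calc _ ≤ |s| * (s ^ 2 + c)⁻¹ := by gcongr; exact h.norm_sqResolvent_le hc s
      _ ≤ |s| * (s ^ 2)⁻¹ := by gcongr; linarith
      _ = |s|⁻¹ := by rw [← sq_abs]; field_simp

/-- Integration by parts: `2 A ∫ (s² + A)⁻² ds = ∫ (s² + A)⁻¹ ds`. -/
lemma Coercive.two_smul_mul_integral {c : ℝ} (hc : 0 < c) {A : Matrix ι ι ℂ} (h : Coercive c A) :
    (2 : ℂ) • (A * ∫ s : ℝ, sqResolvent A s * sqResolvent A s) = ∫ s : ℝ, sqResolvent A s := by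
  have hi := h.integrable_sqResolvent hc
  have hi2 := h.integrable_sqResolvent_sq hc
  have hi3 : Integrable fun s => (2 : ℂ) • (A * (sqResolvent A s * sqResolvent A s)) :=
    (hi2.const_mul A).smul (2 : ℂ)
  have hlim : ∀ l : Filter ℝ, Tendsto (fun s : ℝ => |s|) l atTop →
      Tendsto (fun s : ℝ => (s : ℂ) • sqResolvent A s) l (𝓝 0) := fun l hl =>
    squeeze_zero_norm (fun s => h.norm_smul_sqResolvent_le hc s) (tendsto_inv_atTop_zero.comp hl)
  have h1 := integral_of_hasDerivAt_of_tendsto (h.hasDerivAt_smul_sqResolvent hc) (hi3.sub hi)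
    (hlim _ tendsto_abs_atBot_atTop) (hlim _ tendsto_abs_atTop_atTop)
  rw [integral_sub hi3 hi, integral_smul, sub_self, sub_eq_zero] at h1
  rw [← h1]
  congr 1
  exact (ContinuousLinearMap.integral_comp_comm (ContinuousLinearMap.mul ℂ (Matrix ι ι ℂ) A)
    hi2).symm

lemma Coercive.segment {c : ℝ} {A : Matrix ι ι ℂ} (h : Coercive c A) {τ : ℝ}
    (hτ : τ ∈ Set.Icc (0 : ℝ) 1) :
    Coercive (min 1 c) (1 + (τ : ℂ) • (A - 1)) := by
  intro v
  have h1 : (numForm v (1 + (τ : ℂ) • (A - 1))).re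
      = (1 - τ) * ‖v‖ ^ 2 + τ * (numForm v A).re := by
    rw [map_add, map_smul, map_sub, numForm_one, smul_eq_mul, Complex.add_re,
      Complex.re_ofReal_mul, Complex.sub_re, ← Complex.ofReal_pow, Complex.ofReal_re]
    ring
  rw [h1]
  have h2 := h v
  have h3 := min_le_left 1 c
  have h4 := min_le_right 1 c
  have h5 : min 1 c * ‖v‖ ^ 2 ≤ 1 * ‖v‖ ^ 2 := by gcongr
  have h6 : min 1 c * ‖v‖ ^ 2 ≤ (numForm v A).re := le_trans (by gcongr) h2
  nlinarith [hτ.1, hτ.2]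

lemma invSqrt_one : invSqrt (1 : Matrix ι ι ℂ) = 1 := by
  have h1 : ∀ s : ℝ, sqResolvent (1 : Matrix ι ι ℂ) s
      = (((1 + s ^ 2)⁻¹ : ℝ) : ℂ) • (1 : Matrix ι ι ℂ) := fun s => by
    have h2 : (((1 + s ^ 2 : ℝ)) : ℂ) ≠ 0 := by
      rw [Ne, Complex.ofReal_eq_zero]; positivity
    rw [sqResolvent]
    refine inv_eq_right_inv ?_
    have h3 : ((s ^ 2 : ℝ) : ℂ) • (1 : Matrix ι ι ℂ) + 1
        = ((1 + s ^ 2 : ℝ) : ℂ) • (1 : Matrix ι ι ℂ) := by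
      push_cast; rw [add_smul, one_smul, add_comm]
    rw [h3, smul_mul_smul_comm, Complex.ofReal_inv, mul_inv_cancel₀ h2, one_smul, one_mul]
  rw [invSqrt]
  simp_rw [h1]
  rw [integral_smul_const, integral_complex_ofReal, integral_univ_inv_one_add_sq, smul_smul,
    inv_mul_cancel₀ (by exact_mod_cast Real.pi_ne_zero), one_smul]

lemma commute_integral {f : ℝ → Matrix ι ι ℂ} (hf : Integrable f) {X : Matrix ι ι ℂ}
    (h : ∀ s, Commute X (f s)) : Commute X (∫ s, f s) := by
  have h1 := ContinuousLinearMap.integral_comp_comm (ContinuousLinearMap.mul ℂ (Matrix ι ι ℂ) X) hf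
  have h2 := ContinuousLinearMap.integral_comp_comm
    ((ContinuousLinearMap.mul ℂ (Matrix ι ι ℂ)).flip X) hf
  simp only [ContinuousLinearMap.mul_apply', ContinuousLinearMap.flip_apply] at h1 h2
  rw [Commute, SemiconjBy, ← h1, ← h2]
  exact integral_congr_ae (Eventually.of_forall h)

lemma Coercive.commute_invSqrt {c : ℝ} (hc : 0 < c) {A X : Matrix ι ι ℂ} (hA : Coercive c A)
    (h : Commute X A) : Commute X (invSqrt A) :=
  (commute_integral (hA.integrable_sqResolvent hc) (commute_sqResolvent h)).smul_right _

/-- Along the segment from `1` to `A` the matrix `(A_τ^{-1/2})² A_τ` has zero derivative. -/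
lemma Coercive.hasDerivAt_invSqrt_segment {c : ℝ} (hc : 0 < c) {H : Matrix ι ι ℂ} {τ : ℝ}
    (h : Coercive c (1 + (τ : ℂ) • H)) :
    HasDerivAt (fun τ : ℝ => invSqrt (1 + (τ : ℂ) • H) * invSqrt (1 + (τ : ℂ) • H)
      * (1 + (τ : ℂ) • H)) 0 τ := by
  have hp : HasDerivAt (fun τ : ℝ => 1 + (τ : ℂ) • H) H τ := by
    have h1 : HasDerivAt (fun s : ℝ => (s : ℂ)) 1 τ := Complex.ofRealCLM.hasDerivAt
    simpa using (h1.smul_const H).const_add 1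
  have hR := ((h.hasFDerivAt_invSqrt hc).restrictScalars ℝ).comp_hasDerivAt τ hp
  have hF := (hR.mul hR).mul hp
  set B := 1 + (τ : ℂ) • H with hB
  have hHB : Commute H B := (Commute.one_right H).add_right ((Commute.refl H).smul_right _)
  have hi2 := h.integrable_sqResolvent_sq hc
  set S := ∫ s : ℝ, sqResolvent B s * sqResolvent B s with hS
  have hD : ((Real.pi : ℂ)⁻¹ • ∫ s : ℝ, -ContinuousLinearMap.mulLeftRight ℂ (Matrix ι ι ℂ)
      (sqResolvent B s) (sqResolvent B s)) H = -((Real.pi : ℂ)⁻¹ • (S * H)) := by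
    rw [_root_.smul_apply, integral_neg, _root_.neg_apply, smul_neg]
    have hcont := h.continuous_sqResolvent hc
    have hint : Integrable fun s : ℝ => ContinuousLinearMap.mulLeftRight ℂ (Matrix ι ι ℂ)
        (sqResolvent B s) (sqResolvent B s) := by
      refine ((integrable_inv_sq_add hc).mul_const c⁻¹).mono'
        (((ContinuousLinearMap.mulLeftRight ℂ (Matrix ι ι ℂ)).continuous.comp
          hcont).clm_apply hcont).aestronglyMeasurable (Eventually.of_forall fun s => ?_)
      have h1 := h.norm_sqResolvent_le hc s
      have h2 : (s ^ 2 + c)⁻¹ ≤ c⁻¹ := by gcongr; nlinarith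
      refine (ContinuousLinearMap.opNorm_mulLeftRight_apply_apply_le ℂ (Matrix ι ι ℂ) _ _).trans ?_
      gcongr
      exact h1.trans h2
    rw [ContinuousLinearMap.integral_apply hint]
    have h3 := ContinuousLinearMap.integral_comp_comm
      ((ContinuousLinearMap.mul ℂ (Matrix ι ι ℂ)).flip H) hi2
    simp only [ContinuousLinearMap.flip_apply, ContinuousLinearMap.mul_apply'] at h3
    rw [hS, ← h3]
    congr 2
    refine integral_congr_ae (Eventually.of_forall fun s => ?_)
    simp only [ContinuousLinearMap.mulLeftRight_apply]
    rw [mul_assoc, (commute_sqResolvent hHB s).eq, ← mul_assoc]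
  rw [ContinuousLinearMap.coe_restrictScalars', hD] at hF
  set R := invSqrt B with hR'
  have hHR : Commute H R := h.commute_invSqrt hc hHB
  have hBR : Commute B R := h.commute_invSqrt hc (Commute.refl B)
  have hBS : (2 : ℂ) • (B * ((Real.pi : ℂ)⁻¹ • S)) = R := by
    rw [mul_smul_comm, smul_comm, h.two_smul_mul_integral hc]; rfl
  set T := (Real.pi : ℂ)⁻¹ • S with hT
  have hcomm : ∀ X, Commute X B → Commute X T := fun X hX =>
    (commute_integral hi2 fun s =>
      (commute_sqResolvent hX s).mul_right (commute_sqResolvent hX s)).smul_right _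
  have hHT : Commute H T := hcomm H hHB
  have hBT : Commute B T := hcomm B (Commute.refl B)
  have hRT : Commute R T := by
    rw [← hBS]
    exact (((hBT.mul_left (Commute.refl T))).smul_left _)
  have h0 : (-((Real.pi : ℂ)⁻¹ • (S * H)) * R + R * -((Real.pi : ℂ)⁻¹ • (S * H))) * B
      + R * R * H = 0 := by
    have e0 : (Real.pi : ℂ)⁻¹ • (S * H) = T * H := by rw [hT, smul_mul_assoc]
    have e1 : T * H * R = R * (T * H) := (hRT.mul_right hHR.symm).eq.symm
    have e2 : T * H * B = B * T * H := by rw [mul_assoc, hHB.eq, ← mul_assoc, hBT.eq]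
    have e3 : R * R * H = R * (T * H) * B + R * (T * H) * B := by
      nth_rewrite 2 [← hBS]
      rw [mul_assoc R (T * H) B, e2, ← two_smul ℂ, mul_smul_comm, smul_mul_assoc, mul_assoc]
    rw [e0, neg_mul, mul_neg, e1, e3, add_mul, neg_mul]
    abel
  rw [← h0]
  exact hF

/-- The resolvent integral is an inverse square root: `(A^{-1/2})² A = 1`. -/
lemma Coercive.invSqrt_mul_self_mul {c : ℝ} (hc : 0 < c) {A : Matrix ι ι ℂ} (h : Coercive c A) :
    invSqrt A * invSqrt A * A = 1 := by
  have hc' : 0 < min 1 c := lt_min one_pos hc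
  have hd : ∀ τ ∈ Set.Icc (0 : ℝ) 1, HasDerivAt (fun τ : ℝ => invSqrt (1 + (τ : ℂ) • (A - 1))
      * invSqrt (1 + (τ : ℂ) • (A - 1)) * (1 + (τ : ℂ) • (A - 1))) 0 τ := fun τ hτ =>
    (h.segment hτ).hasDerivAt_invSqrt_segment hc'
  have h1 := constant_of_has_deriv_right_zero
    (fun τ hτ => (hd τ hτ).continuousAt.continuousWithinAt)
    (fun τ hτ => (hd τ ⟨hτ.1, hτ.2.le⟩).hasDerivWithinAt) 1 ⟨zero_le_one, le_rfl⟩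
  simpa [invSqrt_one] using h1

/-- If `⟨u, A u⟩` multiplied by `conj q` has non-negative real part, and so has `q`, then
`q A^{-1/2}` is accretive. -/
lemma Coercive.re_numForm_smul_invSqrt_nonneg {c : ℝ} (hc : 0 < c) {A : Matrix ι ι ℂ}
    (h : Coercive c A) {q : ℂ} (hq : 0 ≤ q.re)
    (hA : ∀ u, 0 ≤ ((starRingEnd ℂ) q * numForm u A).re) (v : EuclideanSpace ℂ ι) :
    0 ≤ (numForm v (q • invSqrt A)).re := by
  have hi := h.integrable_sqResolvent hc
  have h1 := ContinuousLinearMap.integral_comp_comm (numForm v) hi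
  have hint : Integrable fun s => numForm v (sqResolvent A s) := (numForm v).integrable_comp hi
  have h2 : (q • invSqrt A) = (Real.pi : ℂ)⁻¹ • (q • ∫ s, sqResolvent A s) := by
    rw [invSqrt, smul_comm]
  rw [h2, map_smul, map_smul, ← h1, smul_eq_mul, ← Complex.ofReal_inv, Complex.re_ofReal_mul,
    smul_eq_mul, ← integral_const_mul]
  refine mul_nonneg (by positivity) ?_
  have h3 := integral_re (hint.const_mul q)
  simp only [RCLike.re_eq_complex_re] at h3
  rw [← h3]
  refine integral_nonneg fun s => ?_
  have hdet := (isUnit_iff_isUnit_det _).1 (h.shift_isUnit hc s)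
  have h4 := numForm_inv hdet v
  set u := toEuclideanCLM (n := ι) (𝕜 := ℂ)
    (((s ^ 2 : ℝ) : ℂ) • (1 : Matrix ι ι ℂ) + A)⁻¹ v with hu
  have h5 : q * numForm v (sqResolvent A s)
      = (starRingEnd ℂ) ((starRingEnd ℂ) q * (((s ^ 2 * ‖u‖ ^ 2 : ℝ) : ℂ))
        + (starRingEnd ℂ) q * numForm u A) := by
    rw [sqResolvent, h4, map_add, map_add, map_smul, numForm_one, smul_eq_mul]
    push_cast
    simp only [map_add, map_mul, map_pow, Complex.conj_ofReal, Complex.conj_conj]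
    ring
  simp only [Pi.zero_apply]
  rw [h5, Complex.conj_re, Complex.add_re, Complex.re_mul_ofReal, Complex.conj_re]
  have := hA u
  positivity

lemma Coercive.norm_invSqrt_le {c : ℝ} (hc : 0 < c) {A : Matrix ι ι ℂ} (h : Coercive c A) :
    ‖invSqrt A‖ ≤ Real.pi⁻¹ * ∫ s : ℝ, (s ^ 2 + c)⁻¹ := by
  rw [invSqrt, norm_smul, ← Complex.ofReal_inv, Complex.norm_real,
    Real.norm_of_nonneg (by positivity)]
  gcongr
  exact norm_integral_le_of_norm_le (integrable_inv_sq_add hc)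
    (Eventually.of_forall (h.norm_sqResolvent_le hc))

lemma Coercive.invSqrt_mul_mul_invSqrt {c : ℝ} (hc : 0 < c) {A : Matrix ι ι ℂ}
    (h : Coercive c A) : invSqrt A * (A * invSqrt A) = 1 := by
  rw [(h.commute_invSqrt hc (Commute.refl A)).eq, ← mul_assoc, h.invSqrt_mul_self_mul hc]

lemma Coercive.isPrincipalSqrt {d : ℕ} {c : ℝ} (hc : 0 < c) {A : Matrix (Fin d) (Fin d) ℂ}
    (h : Coercive c A) : IsPrincipalSqrt A (A * invSqrt A) := by
  have h1 := h.invSqrt_mul_mul_invSqrt hc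
  have hsq : A * invSqrt A * (A * invSqrt A) = A := by rw [mul_assoc, h1, mul_one]
  refine ⟨hsq, fun z hz => ?_⟩
  have h2 : (invSqrt A)⁻¹ = A * invSqrt A := inv_eq_right_inv h1
  have hdet : IsUnit (invSqrt A).det := isUnit_det_of_right_inverse h1
  have hnum : ∀ v, 0 ≤ (numForm v (A * invSqrt A)).re := fun v => by
    rw [← h2, numForm_inv hdet, Complex.conj_re]
    have h3 := h.re_numForm_smul_invSqrt_nonneg hc (q := 1) (by simp) (fun u => ?_)
      (toEuclideanCLM (n := Fin d) (𝕜 := ℂ) (invSqrt A)⁻¹ v)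
    · rwa [one_smul] at h3
    · rw [map_one, one_mul]
      exact le_trans (by positivity) (h u)
  -- eigenvalues of `A` have positive real part, so those of its root avoid the imaginary axis
  have h0 : 0 < (z ^ 2).re := by
    have h4 : z ^ 2 ∈ spectrum ℂ A := by
      have h5 := spectrum.pow_mem_pow (𝕜 := ℂ) (A * invSqrt A) 2 hz
      rwa [pow_two (A * invSqrt A), hsq] at h5
    exact re_spectrum_pos_of_numForm_pos
      (fun v hv => lt_of_lt_of_le (mul_pos hc (by positivity)) (h v)) h4
  have h6 := re_spectrum_nonneg_of_numForm_nonneg hnum hz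
  refine lt_of_le_of_ne h6 fun h7 => ?_
  rw [pow_two, Complex.mul_re, ← h7] at h0
  nlinarith

lemma Coercive.inv_principalSqrt {d : ℕ} {c : ℝ} (hc : 0 < c) {A : Matrix (Fin d) (Fin d) ℂ}
    (h : Coercive c A) : (principalSqrt A)⁻¹ = invSqrt A := by
  rw [principalSqrt_eq (h.isPrincipalSqrt hc)]
  exact inv_eq_left_inv (h.invSqrt_mul_mul_invSqrt hc)

end Root

/-! ### Julia's lemma for the right half-plane -/

/-- Schwarz–Pick inequality for holomorphic self-maps of the right half-plane, with a real base
point `x`. -/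
lemma schwarz_pick_halfPlane {f : ℂ → ℂ} (hf : DifferentiableOn ℂ f {z | 0 < z.re})
    (hpos : ∀ z : ℂ, 0 < z.re → 0 < (f z).re) {x : ℝ} (hx : 0 < x) {z : ℂ} (hz : 0 < z.re) :
    ‖f z - f x‖ ^ 2 * (x * z.re) ≤ ‖z - x‖ ^ 2 * ((f z).re * (f x).re) := by
  -- the two Cayley transforms, centred at `x` and at `f x`
  set φ : ℂ → ℂ := fun ζ => x * ((1 + ζ) / (1 - ζ)) with hφ
  set w := f x with hw
  have hwpos : 0 < w.re := hpos x (by simpa using hx)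
  set g : ℂ → ℂ := fun ζ => (f (φ ζ) - w) / (f (φ ζ) + (starRingEnd ℂ) w) with hg
  have hne : ∀ ζ ∈ Metric.ball (0 : ℂ) 1, 1 - ζ ≠ 0 := fun ζ hζ h => by
    rw [sub_eq_zero] at h
    rw [← h] at hζ
    simp at hζ
  have hφpos : ∀ ζ ∈ Metric.ball (0 : ℂ) 1, 0 < (φ ζ).re := fun ζ hζ => by
    have h1 : ‖ζ‖ < 1 := by simpa using hζ
    have h2 : 0 < Complex.normSq (1 - ζ) := Complex.normSq_pos.2 (hne ζ hζ)
    have h3 : Complex.normSq ζ < 1 := by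
      rw [Complex.normSq_eq_norm_sq]; nlinarith [norm_nonneg ζ]
    simp only [hφ]
    rw [Complex.re_ofReal_mul]
    refine mul_pos hx ?_
    rw [Complex.div_re, ← add_div]
    refine div_pos ?_ h2
    rw [Complex.normSq_apply] at h3
    simp only [Complex.add_re, Complex.one_re, Complex.sub_re, Complex.add_im, Complex.one_im,
      Complex.sub_im]
    nlinarith
  have hnorm : ∀ u : ℂ, ‖u + (starRingEnd ℂ) w‖ ^ 2 = ‖u - w‖ ^ 2 + 4 * (u.re * w.re) := fun u => by
    rw [← Complex.normSq_eq_norm_sq, ← Complex.normSq_eq_norm_sq, Complex.normSq_apply,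
      Complex.normSq_apply]
    simp only [Complex.add_re, Complex.add_im, Complex.sub_re, Complex.sub_im, Complex.conj_re,
      Complex.conj_im]
    ring
  have hden : ∀ u : ℂ, 0 < u.re → u + (starRingEnd ℂ) w ≠ 0 := fun u hu h => by
    have h1 := congrArg Complex.re h
    simp only [Complex.add_re, Complex.conj_re, Complex.zero_re] at h1
    linarith
  have hgd : DifferentiableOn ℂ g (Metric.ball 0 1) := by
    have hφd : DifferentiableOn ℂ φ (Metric.ball 0 1) := by
      refine DifferentiableOn.const_mul (DifferentiableOn.div (by fun_prop) (by fun_prop) hne) _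
    have h1 : DifferentiableOn ℂ (fun ζ => f (φ ζ)) (Metric.ball 0 1) :=
      hf.comp hφd fun ζ hζ => hφpos ζ hζ
    exact (h1.sub_const _).div (h1.add_const _) fun ζ hζ => hden _ (hpos _ (hφpos ζ hζ))
  have hgm : Set.MapsTo g (Metric.ball 0 1) (Metric.closedBall 0 1) := fun ζ hζ => by
    have hp := hpos _ (hφpos ζ hζ)
    have h1 := hnorm (f (φ ζ))
    have h2 : 0 < ‖f (φ ζ) + (starRingEnd ℂ) w‖ := norm_pos_iff.2 (hden _ hp)
    rw [mem_closedBall_zero_iff]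
    simp only [hg]
    rw [norm_div, div_le_one h2]
    have h3 : 0 < (f (φ ζ)).re * w.re := mul_pos hp hwpos
    nlinarith [norm_nonneg (f (φ ζ) - w)]
  have hg0 : g 0 = 0 := by simp [hg, hφ, hw]
  have hzx : z + x ≠ 0 := fun h => by
    have h1 := congrArg Complex.re h
    simp at h1
    linarith
  have hxc : (x : ℂ) ≠ 0 := by exact_mod_cast hx.ne'
  have hnx : ‖z + x‖ ^ 2 = ‖z - x‖ ^ 2 + 4 * (z.re * x) := by
    rw [← Complex.normSq_eq_norm_sq, ← Complex.normSq_eq_norm_sq, Complex.normSq_apply,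
      Complex.normSq_apply]
    simp only [Complex.add_re, Complex.add_im, Complex.sub_re, Complex.sub_im, Complex.ofReal_re,
      Complex.ofReal_im]
    ring
  have hzx' : 0 < ‖z + x‖ := norm_pos_iff.2 hzx
  set ζ : ℂ := (z - x) / (z + x) with hζ
  have hζlt : ‖ζ‖ < 1 := by
    rw [hζ, norm_div, div_lt_one hzx']
    nlinarith [norm_nonneg (z - x), mul_pos hz hx]
  have hφζ : φ ζ = z := by
    simp only [hφ]
    have e1 : 1 + ζ = 2 * z / (z + x) := by rw [hζ]; field_simp; ring
    have e2 : 1 - ζ = 2 * x / (z + x) := by rw [hζ]; field_simp; ring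
    rw [e1, e2]
    field_simp
  have hmain := Complex.norm_le_norm_of_mapsTo_ball hgd hgm hg0 hζlt
  simp only [hg] at hmain
  rw [hφζ] at hmain
  have hfp : 0 < ‖f z + (starRingEnd ℂ) w‖ := norm_pos_iff.2 (hden _ (hpos z hz))
  rw [hζ, norm_div, norm_div, div_le_div_iff₀ hfp hzx'] at hmain
  have h1 : (‖f z - w‖ * ‖z + x‖) ^ 2 ≤ (‖z - x‖ * ‖f z + (starRingEnd ℂ) w‖) ^ 2 := by gcongr
  rw [mul_pow, mul_pow, hnx, hnorm] at h1
  linarith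

/-- **Julia's lemma**: a holomorphic function with non-negative real part on the right half-plane
and with radial angular derivative `c > 0` at infinity dominates `c Re z`. -/
lemma julia_halfPlane {f : ℂ → ℂ} (hf : DifferentiableOn ℂ f {z | 0 < z.re})
    (hnonneg : ∀ z : ℂ, 0 < z.re → 0 ≤ (f z).re) {c : ℝ} (hc : 0 < c)
    (hlim : Tendsto (fun x : ℝ => (x : ℂ)⁻¹ * f x) atTop (𝓝 (c : ℂ))) {z : ℂ} (hz : 0 < z.re) :
    c * z.re ≤ (f z).re := by
  refine le_of_forall_pos_le_add fun ε hε => ?_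
  have hinv : Tendsto (fun x : ℝ => (x : ℂ)⁻¹) atTop (𝓝 0) := by
    have := (Complex.continuous_ofReal.tendsto 0).comp tendsto_inv_atTop_zero
    simpa [Function.comp_def] using this
  have hlim' : Tendsto (fun x : ℝ => (x : ℂ)⁻¹ * (f x + ε)) atTop (𝓝 (c : ℂ)) := by
    have := hlim.add (hinv.mul_const (ε : ℂ))
    simpa [mul_add] using this
  have hsp : ∀ x : ℝ, 0 < x → ‖(f z + ε) - (f x + ε)‖ ^ 2 * (x * z.re)
      ≤ ‖z - x‖ ^ 2 * ((f z + ε).re * (f x + ε).re) := fun x hx =>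
    schwarz_pick_halfPlane (f := fun z => f z + ε) (hf.add_const _)
      (fun z hz => by
        rw [Complex.add_re, Complex.ofReal_re]; linarith [hnonneg z hz]) hx hz
  have h1 : Tendsto (fun x : ℝ => ‖(x : ℂ)⁻¹ * (f z + ε) - (x : ℂ)⁻¹ * (f x + ε)‖ ^ 2 * z.re) atTop
      (𝓝 (‖0 * (f z + ε) - (c : ℂ)‖ ^ 2 * z.re)) :=
    (((hinv.mul_const _).sub hlim').norm.pow 2).mul_const _
  have h2 : Tendsto (fun x : ℝ => ‖(x : ℂ)⁻¹ * z - 1‖ ^ 2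
      * ((f z + ε).re * ((x : ℂ)⁻¹ * (f x + ε)).re)) atTop
      (𝓝 (‖0 * z - 1‖ ^ 2 * ((f z + ε).re * (c : ℂ).re))) :=
    (((hinv.mul_const _).sub_const _).norm.pow 2).mul
      (((Complex.continuous_re.tendsto _).comp hlim').const_mul _)
  have h3 := le_of_tendsto_of_tendsto h1 h2 ?_
  · simp only [zero_mul, zero_sub, norm_neg, norm_one, one_pow, one_mul, Complex.norm_real,
      Complex.ofReal_re, Real.norm_eq_abs, sq_abs, Complex.add_re] at h3
    have h4 : c * (c * z.re) ≤ c * ((f z).re + ε) := by linarith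
    exact le_of_mul_le_mul_left h4 hc
  · filter_upwards [eventually_gt_atTop (0 : ℝ)] with x hx
    have hxc : (x : ℂ) ≠ 0 := by exact_mod_cast hx.ne'
    have e1 : ‖(x : ℂ)⁻¹ * (f z + ε) - (x : ℂ)⁻¹ * (f x + ε)‖ = x⁻¹ * ‖(f z + ε) - (f x + ε)‖ := by
      rw [← mul_sub, norm_mul, norm_inv, Complex.norm_real, Real.norm_of_nonneg hx.le]
    have e2 : ‖(x : ℂ)⁻¹ * z - 1‖ = x⁻¹ * ‖z - x‖ := by
      rw [← inv_mul_cancel₀ hxc, ← mul_sub, norm_mul, norm_inv, Complex.norm_real,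
        Real.norm_of_nonneg hx.le]
    have e3 : ((x : ℂ)⁻¹ * (f x + ε)).re = x⁻¹ * (f x + ε).re := by
      rw [← Complex.ofReal_inv, Complex.re_ofReal_mul]
    rw [e1, e2, e3]
    have h5 := mul_le_mul_of_nonneg_left (hsp x hx) (by positivity : 0 ≤ (x⁻¹) ^ 3)
    calc _ = (x⁻¹) ^ 3 * (‖(f z + ε) - (f x + ε)‖ ^ 2 * (x * z.re)) := by field_simp
      _ ≤ _ := h5
      _ = _ := by ring

/-! ### Decay of the matrix exponential -/

lemma Coercive.norm_exp_le {ι : Type*} [Fintype ι] [DecidableEq ι] {b : ℝ}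
    {K : Matrix ι ι ℂ} (h : Coercive b K) {y : ℝ} (hy : 0 ≤ y) :
    ‖NormedSpace.exp ((-(y : ℂ)) • K)‖ ≤ Real.exp (-(b * y)) := by
  rw [← l2_opNorm_toEuclideanCLM]
  refine ContinuousLinearMap.opNorm_le_bound _ (by positivity) fun v => ?_
  set u : ℝ → EuclideanSpace ℂ ι := fun s =>
    toEuclideanCLM (n := ι) (𝕜 := ℂ) (NormedSpace.exp (s • (-K))) v with hu
  have hu' : ∀ s, HasDerivAt u (-(toEuclideanCLM (n := ι) (𝕜 := ℂ) K (u s))) s := fun s => by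
    have h1 := hasDerivAt_exp_smul_const' (𝕂 := ℝ) (-K) s
    let ev : Matrix ι ι ℂ →ₗ[ℝ] EuclideanSpace ℂ ι :=
      { toFun := fun A => toEuclideanCLM (n := ι) (𝕜 := ℂ) A v
        map_add' := fun A B => by simp
        map_smul' := fun c A => by
          have : c • A = (c : ℂ) • A := by ext; simp
          rw [this, map_smul]; rfl }
    have h2 := (LinearMap.toContinuousLinearMap ev).hasFDerivAt.comp_hasDerivAt s h1
    have h3 : LinearMap.toContinuousLinearMap ev (-K * NormedSpace.exp (s • (-K)))
        = -(toEuclideanCLM (n := ι) (𝕜 := ℂ) K (u s)) := by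
      simp [ev, hu]
    rw [h3] at h2
    exact h2
  set φ : ℝ → ℝ := fun s => Real.exp (2 * b * s) * ‖u s‖ ^ 2 with hφ
  have hφ' : ∀ s, HasDerivAt φ (Real.exp (2 * b * s) * (2 * b) * ‖u s‖ ^ 2
      + Real.exp (2 * b * s) * (-(2 * (numForm (u s) K).re))) s := fun s => by
    have h1 : HasDerivAt (fun s => Real.exp (2 * b * s)) (Real.exp (2 * b * s) * (2 * b)) s := by
      simpa using ((hasDerivAt_id s).const_mul (2 * b)).exp
    have h2 : HasDerivAt (fun s => ‖u s‖ ^ 2) (-(2 * (numForm (u s) K).re)) s := by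
      have h3 := ((hu' s).inner ℂ (hu' s))
      have h4 := (Complex.reCLM.hasFDerivAt.comp_hasDerivAt s h3)
      have e1 : (Complex.reCLM ∘ fun t => inner ℂ (u t) (u t)) = fun s => ‖u s‖ ^ 2 := by
        funext r
        simp [inner_self_eq_norm_sq_to_K, ← Complex.ofReal_pow]
      have e2 : Complex.reCLM (inner ℂ (u s) (-(toEuclideanCLM (n := ι) (𝕜 := ℂ) K (u s)))
          + inner ℂ (-(toEuclideanCLM (n := ι) (𝕜 := ℂ) K (u s))) (u s))
          = -(2 * (numForm (u s) K).re) := by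
        rw [numForm_apply, inner_neg_right, inner_neg_left]
        simp only [Complex.reCLM_apply, Complex.add_re, Complex.neg_re]
        rw [← inner_conj_symm (u s) (toEuclideanCLM (n := ι) (𝕜 := ℂ) K (u s)), Complex.conj_re]
        ring
      rw [e1, e2] at h4
      exact h4
    exact h1.mul h2
  have hanti : Antitone φ := antitone_of_hasDerivAt_nonpos hφ' fun s => by
    have := h (u s)
    have := Real.exp_pos (2 * b * s)
    simp only [Pi.zero_apply]
    nlinarith
  have h1 := hanti hy
  have h2 : (-(y : ℂ)) • K = y • (-K) := by ext; simp
  rw [h2]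
  change ‖u y‖ ≤ _
  have hu0 : u 0 = v := by simp [hu, NormedSpace.exp_zero]
  simp only [hφ, mul_zero, Real.exp_zero, one_mul, hu0] at h1
  have h3 : (Real.exp (b * y) * ‖u y‖) ^ 2 ≤ ‖v‖ ^ 2 := by
    rw [mul_pow, ← Real.exp_nat_mul]
    have e : ((2 : ℕ) : ℝ) * (b * y) = 2 * b * y := by push_cast; ring
    rw [e]
    exact h1
  rw [Real.exp_neg, inv_mul_eq_div, le_div_iff₀' (Real.exp_pos _)]
  exact (abs_le.1 (abs_le_of_sq_le_sq h3 (norm_nonneg v))).2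

/-! ### Closing the Bromwich contour -/

lemma intervalIntegrable_vertical {f : ℂ → ℂ} (hf : DifferentiableOn ℂ f {p | 0 < p.re}) {σ : ℝ}
    (hσ : 0 < σ) (a b : ℝ) :
    IntervalIntegrable (fun τ : ℝ => f ((σ : ℂ) + (τ : ℂ) * Complex.I)) volume a b := by
  refine Continuous.intervalIntegrable ?_ a b
  exact hf.continuousOn.comp_continuous (by fun_prop) fun τ => by simpa using hσ

/-- If `|f(p)| ≤ C e^{-δ Re p} / |p|` in the right half-plane, then the integral of `f` over
`[σ - iR, σ + iR]` is `O(1/R)`: the rectangle over this segment is closed at `Re p = X → ∞`. -/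
lemma norm_segmentIntegral_le {f : ℂ → ℂ} (hf : DifferentiableOn ℂ f {p | 0 < p.re}) {C δ : ℝ}
    (hC : 0 ≤ C) (hδ : 0 < δ)
    (hb : ∀ p : ℂ, 0 < p.re → ‖f p‖ ≤ C * Real.exp (-δ * p.re) / ‖p‖) {σ : ℝ} (hσ : 0 < σ)
    {R : ℝ} (hR : 0 < R) : ‖segmentIntegral σ f R‖ ≤ 2 * (C / (δ * R)) := by
  have hrect : ∀ X : ℝ, σ < X → ‖segmentIntegral σ f R‖ ≤
      2 * (C / (δ * R)) + C * Real.exp (-δ * X) / X * (2 * R) := fun X hX => by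
    have hX0 : 0 < X := hσ.trans hX
    have h1 := Complex.integral_boundary_rect_eq_zero_of_differentiableOn f ⟨σ, -R⟩ ⟨X, R⟩ ?_
    · simp only [smul_eq_mul] at h1
      have hseg : segmentIntegral σ f R
          = Complex.I * ∫ y : ℝ in (-R)..R, f (σ + y * Complex.I) := by
        rw [segmentIntegral, intervalIntegral.integral_mul_const, mul_comm]
      -- the horizontal sides
      have hside : ∀ r : ℝ, |r| = R → ‖∫ x : ℝ in σ..X, f (x + r * Complex.I)‖ ≤ C / (δ * R) := by
        intro r hr
        have hexp : IntervalIntegrable (fun x : ℝ => C / R * Real.exp (-δ * x)) volume σ X :=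
          Continuous.intervalIntegrable (by fun_prop) _ _
        refine (intervalIntegral.norm_integral_le_of_norm_le hX.le
          (Eventually.of_forall fun x hx => ?_) hexp).trans ?_
        · have hx0 : 0 < x := hσ.trans hx.1
          have h2 := hb (x + r * Complex.I) (by simpa using hx0)
          have h3 : R ≤ ‖(x : ℂ) + r * Complex.I‖ := by
            have := Complex.abs_im_le_norm ((x : ℂ) + r * Complex.I)
            simpa [hr] using this
          have h4 : ((x : ℂ) + r * Complex.I).re = x := by simp
          rw [h4] at h2
          calc _ ≤ _ := h2
            _ ≤ C * Real.exp (-δ * x) / R := by gcongr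
            _ = _ := by ring
        · rw [intervalIntegral.integral_const_mul]
          have h5 : ∫ x in σ..X, Real.exp (-δ * x)
              = (Real.exp (-δ * σ) - Real.exp (-δ * X)) / δ := by
            have h6 : ∀ x ∈ Set.uIcc σ X, HasDerivAt (fun x => -Real.exp (-δ * x) / δ)
                (Real.exp (-δ * x)) x := fun x _ => by
              have h7 := (((hasDerivAt_id x).const_mul (-δ)).exp.neg).div_const δ
              exact h7.congr_deriv (by simp only [id, mul_one]; field_simp)
            rw [intervalIntegral.integral_eq_sub_of_hasDerivAt h6
              (Continuous.intervalIntegrable (by fun_prop) _ _)]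
            ring
          rw [h5]
          have h8 : Real.exp (-δ * σ) - Real.exp (-δ * X) ≤ 1 := by
            have := Real.exp_pos (-δ * X)
            have : Real.exp (-δ * σ) ≤ 1 := Real.exp_le_one_iff.2 (by nlinarith)
            linarith
          calc _ ≤ C / R * (1 / δ) := by gcongr
            _ = _ := by field_simp
      -- the right vertical side
      have hright : ‖∫ y : ℝ in (-R)..R, f (X + y * Complex.I)‖
          ≤ C * Real.exp (-δ * X) / X * (2 * R) := by
        have h2 := intervalIntegral.norm_integral_le_of_norm_le_const (a := -R) (b := R)
          (f := fun y : ℝ => f (X + y * Complex.I)) (C := C * Real.exp (-δ * X) / X)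
          fun y _ => by
            have h3 := hb (X + y * Complex.I) (by simpa using hX0)
            have h4 : ((X : ℂ) + y * Complex.I).re = X := by simp
            have h5 : X ≤ ‖(X : ℂ) + y * Complex.I‖ := by
              have := Complex.abs_re_le_norm ((X : ℂ) + y * Complex.I)
              rw [h4] at this
              exact (le_abs_self X).trans this
            rw [h4] at h3
            exact h3.trans (by gcongr)
        have h6 : |R - -R| = 2 * R := by rw [abs_of_pos] <;> linarith
        rwa [h6] at h2
      have h9 : segmentIntegral σ f R = (∫ x : ℝ in σ..X, f (x + ((-R : ℝ) : ℂ) * Complex.I))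
          - (∫ x : ℝ in σ..X, f (x + (R : ℂ) * Complex.I))
          + Complex.I * ∫ y : ℝ in (-R)..R, f (X + y * Complex.I) := by
        rw [hseg]
        linear_combination -h1
      rw [h9]
      have t1 := hside (-R) (by rw [abs_neg, abs_of_pos hR])
      have t2 := hside R (abs_of_pos hR)
      refine (norm_add_le _ _).trans ?_
      rw [norm_mul, Complex.norm_I, one_mul]
      refine add_le_add ((norm_sub_le _ _).trans ?_) hright
      linarith
    · refine hf.mono fun p hp => ?_
      have h2 := (Complex.mem_reProdIm.1 hp).1
      simp only [Set.uIcc_of_le hX.le] at h2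
      exact hσ.trans_le h2.1
  have hlim : Tendsto (fun X : ℝ => 2 * (C / (δ * R)) + C * Real.exp (-δ * X) / X * (2 * R)) atTop
      (𝓝 (2 * (C / (δ * R)) + C * 0 * 0 * (2 * R))) := by
    have h1 : Tendsto (fun X : ℝ => Real.exp (-δ * X)) atTop (𝓝 0) :=
      Real.tendsto_exp_atBot.comp (tendsto_id.const_mul_atTop_of_neg (by linarith))
    exact (((h1.const_mul C).mul tendsto_inv_atTop_zero).mul_const (2 * R)).const_add _
  have := ge_of_tendsto hlim (by filter_upwards [eventually_gt_atTop σ] with X hX using hrect X hX)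
  simpa using this

lemma tendsto_segmentIntegral_zero {f : ℂ → ℂ} (hf : DifferentiableOn ℂ f {p | 0 < p.re})
    {C δ : ℝ} (hC : 0 ≤ C) (hδ : 0 < δ)
    (hb : ∀ p : ℂ, 0 < p.re → ‖f p‖ ≤ C * Real.exp (-δ * p.re) / ‖p‖) {σ : ℝ} (hσ : 0 < σ) :
    Tendsto (segmentIntegral σ f) atTop (𝓝 0) := by
  refine squeeze_zero_norm' (a := fun R => 2 * (C / δ * R⁻¹)) ?_ ?_
  · filter_upwards [eventually_gt_atTop (0 : ℝ)] with R hR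
    refine (norm_segmentIntegral_le hf hC hδ hb hσ hR).trans (le_of_eq ?_)
    field_simp
  · simpa using (tendsto_inv_atTop_zero.const_mul (C / δ)).const_mul (2 : ℝ)

/-! ### Laplace transforms of bounded continuous functions -/

/-- The Laplace transform of a real function on `]0, ∞[`. -/
noncomputable def laplace (φ : ℝ → ℝ) (p : ℂ) : ℂ :=
  ∫ t in Set.Ioi (0 : ℝ), Complex.exp (-p * (t : ℂ)) * (φ t : ℂ)

/-- Bounded continuous functions on `]0, ∞[`; nothing is required of the values elsewhere. -/
structure IsBddCont (φ : ℝ → ℝ) : Prop where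
  continuousOn : ContinuousOn φ (Set.Ioi 0)
  bounded : ∃ C : ℝ, ∀ t : ℝ, 0 < t → |φ t| ≤ C

lemma IsBddCont.add {φ ψ : ℝ → ℝ} (hφ : IsBddCont φ) (hψ : IsBddCont ψ) :
    IsBddCont fun t => φ t + ψ t := by
  obtain ⟨C, hC⟩ := hφ.bounded
  obtain ⟨D, hD⟩ := hψ.bounded
  exact ⟨hφ.continuousOn.add hψ.continuousOn, C + D, fun t ht =>
    (abs_add_le _ _).trans (add_le_add (hC t ht) (hD t ht))⟩

lemma IsBddCont.const_mul {φ : ℝ → ℝ} (hφ : IsBddCont φ) (a : ℝ) :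
    IsBddCont fun t => a * φ t := by
  obtain ⟨C, hC⟩ := hφ.bounded
  refine ⟨continuousOn_const.mul hφ.continuousOn, |a| * C, fun t ht => ?_⟩
  rw [abs_mul]
  exact mul_le_mul_of_nonneg_left (hC t ht) (abs_nonneg a)

lemma IsBddCont.congr {φ ψ : ℝ → ℝ} (hφ : IsBddCont φ) (h : ∀ t, 0 < t → ψ t = φ t) :
    IsBddCont ψ := by
  obtain ⟨C, hC⟩ := hφ.bounded
  exact ⟨hφ.continuousOn.congr fun t ht => h t ht, C, fun t ht => (h t ht).symm ▸ hC t ht⟩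

lemma norm_exp_neg_mul (p : ℂ) (t : ℝ) : ‖Complex.exp (-p * (t : ℂ))‖ = Real.exp (-p.re * t) := by
  rw [Complex.norm_exp, Complex.re_mul_ofReal, Complex.neg_re]

lemma IsBddCont.aestronglyMeasurable {φ : ℝ → ℝ} (hφ : IsBddCont φ) (p : ℂ) :
    AEStronglyMeasurable (fun t : ℝ => Complex.exp (-p * (t : ℂ)) * (φ t : ℂ))
      (volume.restrict (Set.Ioi 0)) := by
  refine ContinuousOn.aestronglyMeasurable ?_ measurableSet_Ioi
  refine ContinuousOn.mul (by fun_prop) ?_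
  exact Complex.continuous_ofReal.comp_continuousOn hφ.continuousOn

lemma IsBddCont.integrableOn {φ : ℝ → ℝ} (hφ : IsBddCont φ) {p : ℂ} (hp : 0 < p.re) :
    IntegrableOn (fun t : ℝ => Complex.exp (-p * (t : ℂ)) * (φ t : ℂ)) (Set.Ioi 0) := by
  obtain ⟨C, hC⟩ := hφ.bounded
  refine Integrable.mono' ((exp_neg_integrableOn_Ioi 0 hp).mul_const C) (hφ.aestronglyMeasurable p)
    ((ae_restrict_iff' measurableSet_Ioi).2 (Eventually.of_forall fun t ht => ?_))
  rw [norm_mul, norm_exp_neg_mul, Complex.norm_real]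
  gcongr
  exact hC t ht

lemma laplace_const_mul (a : ℝ) (φ : ℝ → ℝ) (p : ℂ) :
    laplace (fun t => a * φ t) p = a * laplace φ p := by
  rw [laplace, laplace, ← integral_const_mul]
  congr 1; funext t; push_cast; ring

lemma laplace_congr {φ ψ : ℝ → ℝ} (h : ∀ t, 0 < t → φ t = ψ t) (p : ℂ) :
    laplace φ p = laplace ψ p :=
  setIntegral_congr_fun measurableSet_Ioi fun t ht => by simp only [h t ht]

lemma laplace_sum {α : Type*} (s : Finset α) {φ : α → ℝ → ℝ} (hφ : ∀ a ∈ s, IsBddCont (φ a)) {p : ℂ}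
    (hp : 0 < p.re) :
    laplace (fun t => ∑ a ∈ s, φ a t) p = ∑ a ∈ s, laplace (φ a) p := by
  simp only [laplace]
  rw [← integral_finsetSum s fun a ha => (hφ a ha).integrableOn hp]
  congr 1; funext t; push_cast; rw [Finset.mul_sum]

lemma IsBddCont.sum {α : Type*} (s : Finset α) {φ : α → ℝ → ℝ} (hφ : ∀ a ∈ s, IsBddCont (φ a)) :
    IsBddCont fun t => ∑ a ∈ s, φ a t := by
  classical
  induction s using Finset.induction_on with
  | empty => exact ⟨by simpa using continuousOn_const, 0, by simp⟩
  | insert a s ha ih =>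
    refine ((hφ a (Finset.mem_insert_self a s)).add
      (ih fun b hb => hφ b (Finset.mem_insert_of_mem hb))).congr fun t _ => ?_
    rw [Finset.sum_insert ha]

lemma IsBddCont.differentiableAt_laplace {φ : ℝ → ℝ} (hφ : IsBddCont φ) {p : ℂ} (hp : 0 < p.re) :
    DifferentiableAt ℂ (laplace φ) p := by
  obtain ⟨C, hC⟩ := hφ.bounded
  have hC0 : 0 ≤ C := (abs_nonneg _).trans (hC 1 one_pos)
  set b := p.re / 4 with hb
  have hb0 : 0 < b := by positivity
  refine (hasDerivAt_integral_of_dominated_loc_of_deriv_le (μ := volume.restrict (Set.Ioi 0))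
    (F := fun p t => Complex.exp (-p * (t : ℂ)) * (φ t : ℂ))
    (F' := fun p t => (t : ℂ) * (-(Complex.exp (-p * (t : ℂ)) * (φ t : ℂ))))
    (bound := fun t => (C / b) * Real.exp (-b * t))
    (Metric.ball_mem_nhds p (show 0 < 2 * b by positivity))
    (Eventually.of_forall fun q => hφ.aestronglyMeasurable q)
    (hφ.integrableOn hp) ?_ ?_ ?_ ?_).2.differentiableAt
  · exact (Complex.continuous_ofReal.aestronglyMeasurable).mul (hφ.aestronglyMeasurable p).neg
  · refine (ae_restrict_iff' measurableSet_Ioi).2 (Eventually.of_forall fun t ht q hq => ?_)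
    have ht0 : (0 : ℝ) < t := ht
    have h1 : 2 * b ≤ q.re := by
      have h2 := (Complex.abs_re_le_norm (q - p)).trans (mem_ball_iff_norm.1 hq).le
      rw [Complex.sub_re, abs_le] at h2
      linarith [h2.1]
    rw [norm_mul, norm_neg, norm_mul, norm_exp_neg_mul, Complex.norm_real, Complex.norm_real,
      Real.norm_of_nonneg ht0.le]
    -- one of the two factors `e^{-bt}` absorbs `t`
    have h3 : t ≤ Real.exp (b * t) / b := by
      rw [le_div_iff₀ hb0]
      linarith [Real.add_one_le_exp (b * t)]
    calc t * (Real.exp (-q.re * t) * |φ t|)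
        ≤ Real.exp (b * t) / b * (Real.exp (-(2 * b) * t) * C) := by
          gcongr
          exact hC t ht
      _ = C / b * (Real.exp (b * t) * Real.exp (-(2 * b) * t)) := by ring
      _ = _ := by rw [← Real.exp_add]; ring_nf
  · exact (exp_neg_integrableOn_Ioi 0 hb0).const_mul _
  · refine Eventually.of_forall fun t q _ => ?_
    have h1 : HasDerivAt (fun q : ℂ => -q * (t : ℂ)) (-(t : ℂ)) q := by
      simpa using ((hasDerivAt_id q).neg.mul_const (t : ℂ))
    exact (h1.cexp.mul_const (φ t : ℂ)).congr_deriv (by ring)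

/-- Initial value theorem: `x φ̂(x) → φ(0+)` as `x → +∞`. -/
lemma IsBddCont.tendsto_mul_laplace {φ : ℝ → ℝ} (hφ : IsBddCont φ) {φ₀ : ℝ}
    (h0 : Tendsto φ (𝓝[>] 0) (𝓝 φ₀)) :
    Tendsto (fun x : ℝ => (x : ℂ) * laplace φ x) atTop (𝓝 (φ₀ : ℂ)) := by
  obtain ⟨C, hC⟩ := hφ.bounded
  have hsub : ∀ x : ℝ, 0 < x → (x : ℂ) * laplace φ x
      = ∫ u in Set.Ioi (0 : ℝ), ((Real.exp (-1 * u) * φ (u / x) : ℝ) : ℂ) := fun x hx => by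
    have h1 := integral_comp_mul_left_Ioi'
      (fun u => ((Real.exp (-1 * u) * φ (u / x) : ℝ) : ℂ)) 0 hx
    rw [mul_zero] at h1
    rw [← h1, laplace, Complex.real_smul]
    congr 2
    funext t
    rw [mul_div_cancel_left₀ _ hx.ne']
    push_cast
    congr 2
    ring
  have hint1 : ∫ u in Set.Ioi (0 : ℝ), ((Real.exp (-1 * u) * φ₀ : ℝ) : ℂ) = φ₀ := by
    rw [integral_complex_ofReal, integral_mul_const]
    simp only [neg_mul, one_mul]
    rw [integral_exp_neg_Ioi_zero, one_mul]
  have key : Tendsto (fun x : ℝ => ∫ u in Set.Ioi (0 : ℝ),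
      ((Real.exp (-1 * u) * φ (u / x) : ℝ) : ℂ)) atTop (𝓝 φ₀) := by
    rw [← hint1]
    refine tendsto_integral_filter_of_dominated_convergence
      (fun u => Real.exp (-1 * u) * C) ?_ ?_ ?_ ?_
    · filter_upwards [eventually_gt_atTop (0 : ℝ)] with x hx
      refine ContinuousOn.aestronglyMeasurable ?_ measurableSet_Ioi
      refine Complex.continuous_ofReal.comp_continuousOn (ContinuousOn.mul (by fun_prop) ?_)
      exact hφ.continuousOn.comp (by fun_prop) fun u hu => div_pos hu hx
    · filter_upwards [eventually_gt_atTop (0 : ℝ)] with x hx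
      refine (ae_restrict_iff' measurableSet_Ioi).2 (Eventually.of_forall fun u hu => ?_)
      rw [Complex.norm_real, norm_mul, Real.norm_of_nonneg (Real.exp_pos _).le]
      gcongr
      exact hC _ (div_pos hu hx)
    · exact (exp_neg_integrableOn_Ioi 0 one_pos).mul_const C
    · refine (ae_restrict_iff' measurableSet_Ioi).2 (Eventually.of_forall fun u hu => ?_)
      refine (Complex.continuous_ofReal.tendsto _).comp (Tendsto.const_mul _ (h0.comp ?_))
      refine tendsto_nhdsWithin_iff.2 ⟨Tendsto.const_div_atTop tendsto_id u, ?_⟩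
      filter_upwards [eventually_gt_atTop (0 : ℝ)] with x hx using div_pos hu hx
  refine key.congr' ?_
  filter_upwards [eventually_gt_atTop (0 : ℝ)] with x hx using (hsub x hx).symm

/-! ### Laplace transforms of completely monotonic functions -/

lemma CompletelyMonotonic.nonneg {f : ℝ → ℝ} (hf : CompletelyMonotonic f) {t : ℝ} (ht : 0 < t) :
    0 ≤ f t := by simpa using hf.2 0 t ht

lemma CompletelyMonotonic.hasDerivAt {f : ℝ → ℝ} (hf : CompletelyMonotonic f) {t : ℝ}
    (ht : 0 < t) : HasDerivAt f (deriv f t) t :=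
  ((hf.1.contDiffAt (Ioi_mem_nhds ht)).differentiableAt (by simp)).hasDerivAt

lemma CompletelyMonotonic.deriv_nonpos {f : ℝ → ℝ} (hf : CompletelyMonotonic f) {t : ℝ}
    (ht : 0 < t) : deriv f t ≤ 0 := by
  have := hf.2 1 t ht
  rw [iteratedDeriv_one] at this
  linarith

lemma CompletelyMonotonic.hasDerivAt_deriv {f : ℝ → ℝ} (hf : CompletelyMonotonic f) {t : ℝ}
    (ht : 0 < t) : HasDerivAt (deriv f) (deriv (deriv f) t) t := by
  have h1 : ContDiffOn ℝ 1 (deriv f) (Set.Ioi 0) :=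
    (contDiffOn_infty_iff_deriv_of_isOpen isOpen_Ioi |>.1 hf.1).2.of_le (by exact_mod_cast le_top)
  exact ((h1.contDiffAt (Ioi_mem_nhds ht)).differentiableAt (by simp)).hasDerivAt

lemma CompletelyMonotonic.deriv_deriv_nonneg {f : ℝ → ℝ} (hf : CompletelyMonotonic f) {t : ℝ}
    (ht : 0 < t) : 0 ≤ deriv (deriv f) t := by
  have := hf.2 2 t ht
  rw [iteratedDeriv_succ, iteratedDeriv_one] at this
  linarith

lemma CompletelyMonotonic.antitoneOn {f : ℝ → ℝ} (hf : CompletelyMonotonic f) :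
    AntitoneOn f (Set.Ioi 0) :=
  antitoneOn_of_deriv_nonpos (convex_Ioi 0) hf.1.continuousOn
    (fun _ ht => (hf.hasDerivAt (interior_subset ht)).differentiableAt.differentiableWithinAt)
    fun _ ht => hf.deriv_nonpos (interior_subset ht)

lemma CompletelyMonotonic.monotoneOn_deriv {f : ℝ → ℝ} (hf : CompletelyMonotonic f) :
    MonotoneOn (deriv f) (Set.Ioi 0) :=
  monotoneOn_of_deriv_nonneg (convex_Ioi 0)
    (fun _ ht => (hf.hasDerivAt_deriv ht).continuousAt.continuousWithinAt)
    (fun _ ht => (hf.hasDerivAt_deriv (interior_subset ht)).differentiableAt.differentiableWithinAt)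
    fun _ ht => hf.deriv_deriv_nonneg (interior_subset ht)

lemma CompletelyMonotonic.le_limit_zero {f : ℝ → ℝ} (hf : CompletelyMonotonic f) {f₀ : ℝ}
    (h0 : Tendsto f (𝓝[>] 0) (𝓝 f₀)) {t : ℝ} (ht : 0 < t) : f t ≤ f₀ := by
  refine ge_of_tendsto h0 ?_
  filter_upwards [Ioo_mem_nhdsGT ht] with s hs using hf.antitoneOn hs.1 ht hs.2.le

lemma CompletelyMonotonic.isBddCont {f : ℝ → ℝ} (hf : CompletelyMonotonic f) {f₀ : ℝ}
    (h0 : Tendsto f (𝓝[>] 0) (𝓝 f₀)) : IsBddCont f :=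
  ⟨hf.1.continuousOn, f₀, fun t ht => by
    rw [abs_of_nonneg (hf.nonneg ht)]; exact hf.le_limit_zero h0 ht⟩

/-- A lower bound of an improper integral from lower bounds over `[ε, T n]`. -/
lemma le_integral_Ioi_of_le {φ r : ℝ → ℝ} (hφ : IntegrableOn φ (Set.Ioi 0)) {a T : ℕ → ℝ} {A : ℝ}
    (hT : Tendsto T atTop atTop) (ha : Tendsto a atTop (𝓝 A)) (hr : Tendsto r (𝓝[>] 0) (𝓝 0))
    (h : ∀ ε, 0 < ε → ∀ n, ε < T n → a n - r ε ≤ ∫ t in ε..T n, φ t) :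
    A ≤ ∫ t in Set.Ioi 0, φ t := by
  have h1 : ∀ ε, 0 < ε → A - r ε ≤ ∫ t in Set.Ioi ε, φ t := fun ε hε => by
    have h2 := intervalIntegral_tendsto_integral_Ioi ε
      (hφ.mono_set (Set.Ioi_subset_Ioi hε.le)) hT
    refine le_of_tendsto_of_tendsto (ha.sub_const (r ε)) h2 ?_
    filter_upwards [hT.eventually_gt_atTop ε] with n hn using h ε hε n hn
  have h3 : Tendsto (fun ε : ℝ => ε) (𝓝[>] 0) (𝓝 0) := tendsto_nhdsWithin_of_tendsto_nhds tendsto_id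
  have h4 := (aecover_Ioi_of_Ioi (μ := volume) h3).integral_tendsto_of_countably_generated hφ
  have h5 : Tendsto (fun ε => A - r ε) (𝓝[>] 0) (𝓝 A) := by simpa using hr.const_sub A
  refine le_of_tendsto_of_tendsto h5 h4 ?_
  filter_upwards [self_mem_nhdsWithin] with ε hε
  rw [Measure.restrict_restrict measurableSet_Ioi,
    Set.inter_eq_left.2 (Set.Ioi_subset_Ioi (le_of_lt hε))]
  exact h1 ε hε

lemma exp_neg_mul_re (p : ℂ) (t : ℝ) :
    (Complex.exp (-p * (t : ℂ))).re = Real.exp (-p.re * t) * Real.cos (p.im * t) := by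
  rw [Complex.exp_re]
  simp

lemma exp_neg_mul_im (p : ℂ) (t : ℝ) :
    (Complex.exp (-p * (t : ℂ))).im = -(Real.exp (-p.re * t) * Real.sin (p.im * t)) := by
  rw [Complex.exp_im]
  simp

lemma hasDerivAt_exp_neg_mul (x t : ℝ) :
    HasDerivAt (fun t => Real.exp (-x * t)) (-x * Real.exp (-x * t)) t :=
  (((hasDerivAt_id t).const_mul (-x)).exp).congr_deriv (by simp only [id]; ring)

lemma hasDerivAt_cos_mul (w t : ℝ) :
    HasDerivAt (fun t => Real.cos (w * t)) (-(w * Real.sin (w * t))) t :=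
  (((hasDerivAt_id t).const_mul w).cos).congr_deriv (by simp only [id]; ring)

lemma hasDerivAt_sin_mul (w t : ℝ) :
    HasDerivAt (fun t => Real.sin (w * t)) (w * Real.cos (w * t)) t :=
  (((hasDerivAt_id t).const_mul w).sin).congr_deriv (by simp only [id]; ring)

/-- `Re (p f̂(p)) ≥ f(∞)` for a completely monotonic `f`. -/
lemma CompletelyMonotonic.le_re_mul_laplace {f : ℝ → ℝ} (hf : CompletelyMonotonic f) {f₀ f₁ : ℝ}
    (h0 : Tendsto f (𝓝[>] 0) (𝓝 f₀)) (h1 : Tendsto f atTop (𝓝 f₁)) {p : ℂ} (hp : 0 < p.re) :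
    f₁ ≤ (p * laplace f p).re := by
  have hint := (hf.isBddCont h0).integrableOn hp
  have hint' := hint.const_mul p
  have hre : (p * laplace f p).re
      = ∫ t in Set.Ioi (0 : ℝ), (p * (Complex.exp (-p * (t : ℂ)) * (f t : ℂ))).re := by
    rw [laplace, ← integral_const_mul]
    exact (integral_re hint').symm
  set k : ℝ → ℝ := fun t => Real.exp (-p.re * t) * Real.cos (p.im * t) with hk
  have hφ : ∀ t : ℝ, (p * (Complex.exp (-p * (t : ℂ)) * (f t : ℂ))).re
      = (p.re * Real.exp (-p.re * t) * Real.cos (p.im * t)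
        + p.im * Real.exp (-p.re * t) * Real.sin (p.im * t)) * f t := fun t => by
    rw [← mul_assoc, Complex.re_mul_ofReal, Complex.mul_re, exp_neg_mul_re, exp_neg_mul_im]
    ring
  have hk' : ∀ t, HasDerivAt k (-(p.re * Real.exp (-p.re * t) * Real.cos (p.im * t)
        + p.im * Real.exp (-p.re * t) * Real.sin (p.im * t))) t := fun t =>
    ((hasDerivAt_exp_neg_mul p.re t).mul (hasDerivAt_cos_mul p.im t)).congr_deriv (by ring)
  have hk1 : ∀ t, 0 < t → k t ≤ 1 := fun t ht => by
    have e1 : Real.exp (-p.re * t) ≤ 1 := Real.exp_le_one_iff.2 (by nlinarith)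
    have e2 := Real.cos_le_one (p.im * t)
    have e3 := Real.exp_pos (-p.re * t)
    simp only [hk]
    nlinarith
  have hkcont : Continuous k := by fun_prop
  have hk0 : k 0 = 1 := by simp [hk]
  have hklim : Tendsto k atTop (𝓝 0) := by
    have e : Tendsto (fun t : ℝ => Real.exp (-p.re * t)) atTop (𝓝 0) :=
      Real.tendsto_exp_atBot.comp (tendsto_id.const_mul_atTop_of_neg (by linarith))
    refine squeeze_zero_norm (fun t => ?_) e
    rw [norm_mul, Real.norm_of_nonneg (Real.exp_pos _).le]
    exact mul_le_of_le_one_right (Real.exp_pos _).le (Real.abs_cos_le_one _)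
  rw [hre]
  refine le_integral_Ioi_of_le (r := fun ε => (1 - k ε) * f ε) (T := fun n : ℕ => (n : ℝ))
    (a := fun n : ℕ => (1 - k n) * f n) hint'.re tendsto_natCast_atTop_atTop ?_ ?_ ?_
  · have := ((hklim.const_sub 1).mul h1).comp tendsto_natCast_atTop_atTop
    simpa [Function.comp_def] using this
  · have e : Tendsto (fun ε => 1 - k ε) (𝓝[>] 0) (𝓝 (1 - k 0)) :=
      tendsto_nhdsWithin_of_tendsto_nhds ((continuous_const.sub hkcont).tendsto 0)
    have := e.mul h0
    simpa [hk0] using this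
  · -- the derivative of `(1 - k) f` is at most `-k' f`, as `k ≤ 1` and `f' ≤ 0`
    intro ε hε n hn
    have hd : ∀ t, 0 < t → HasDerivAt (fun t => (1 - k t) * f t)
        ((p.re * Real.exp (-p.re * t) * Real.cos (p.im * t)
          + p.im * Real.exp (-p.re * t) * Real.sin (p.im * t)) * f t
          + (1 - k t) * deriv f t) t := fun t ht =>
      (((hk' t).const_sub 1).mul (hf.hasDerivAt ht)).congr_deriv (by ring)
    refine intervalIntegral.sub_le_integral_of_hasDeriv_right_of_le
      (g := fun t => (1 - k t) * f t) hn.le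
      (fun t ht => (hd t (hε.trans_le ht.1)).continuousAt.continuousWithinAt)
      (fun t ht => (hd t (hε.trans ht.1)).hasDerivWithinAt)
      (IntegrableOn.mono_set hint'.re fun t ht => hε.trans_le ht.1) fun t ht => ?_
    have ht0 : 0 < t := hε.trans ht.1
    simp only [RCLike.re_eq_complex_re]
    rw [hφ]
    have := mul_nonpos_of_nonneg_of_nonpos (sub_nonneg.2 (hk1 t ht0)) (hf.deriv_nonpos ht0)
    linarith

/-- A convexity bound for the derivative near `0`. -/
lemma CompletelyMonotonic.neg_deriv_le {f : ℝ → ℝ} (hf : CompletelyMonotonic f) {f₀ : ℝ}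
    (h0 : Tendsto f (𝓝[>] 0) (𝓝 f₀)) {t : ℝ} (ht : 0 < t) : -deriv f t ≤ 2 * f₀ / t := by
  obtain ⟨s, hs, hsl⟩ := exists_hasDerivAt_eq_slope f (deriv f) (half_lt_self ht)
    (fun s hs =>
      (hf.hasDerivAt (lt_of_lt_of_le (half_pos ht) hs.1)).continuousAt.continuousWithinAt)
    (fun s hs => hf.hasDerivAt ((half_pos ht).trans hs.1))
  have hs0 : 0 < s := (half_pos ht).trans hs.1
  have h1 := hf.monotoneOn_deriv hs0 ht hs.2.le
  have h2 := hf.le_limit_zero h0 (half_pos ht)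
  have h3 := hf.nonneg ht
  rw [hsl, sub_half, div_le_iff₀ (half_pos ht)] at h1
  rw [le_div_iff₀ ht]
  linarith

/-- `Re f̂(p) ≥ 0` for a completely monotonic `f`: the function `h = e^{-t Re p} f` is convex, and
`w² ∫ h cos(w t) dt = ∫ h'' (1 - cos(w t)) dt`. -/
lemma CompletelyMonotonic.re_laplace_nonneg {f : ℝ → ℝ} (hf : CompletelyMonotonic f) {f₀ : ℝ}
    (h0 : Tendsto f (𝓝[>] 0) (𝓝 f₀)) {p : ℂ} (hp : 0 < p.re) : 0 ≤ (laplace f p).re := by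
  have hint := (hf.isBddCont h0).integrableOn hp
  have hre : (laplace f p).re
      = ∫ t in Set.Ioi (0 : ℝ), (Complex.exp (-p * (t : ℂ)) * (f t : ℂ)).re :=
    (integral_re hint).symm
  have hf₀ : 0 ≤ f₀ := (hf.nonneg one_pos).trans (hf.le_limit_zero h0 one_pos)
  set w := |p.im| with hw
  set x := p.re with hx
  have hφ : ∀ t : ℝ, 0 < t → (Complex.exp (-p * (t : ℂ)) * (f t : ℂ)).re
      = Real.exp (-x * t) * f t * Real.cos (w * t) := fun t ht => by
    rw [Complex.re_mul_ofReal, exp_neg_mul_re, ← Real.cos_abs (p.im * t), abs_mul, abs_of_pos ht]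
    ring
  rcases (abs_nonneg p.im).eq_or_lt with hw0 | hw0
  · rw [hre]
    refine setIntegral_nonneg measurableSet_Ioi fun t ht => ?_
    rw [hφ t ht, hw, ← hw0, zero_mul, Real.cos_zero, mul_one]
    exact mul_nonneg (Real.exp_pos _).le (hf.nonneg ht)
  rw [← hw] at hw0
  -- `h' = e^{-xt} (f' - x f)`
  set h' : ℝ → ℝ := fun t => Real.exp (-x * t) * (deriv f t - x * f t) with hh'
  set Ψ : ℝ → ℝ := fun t => Real.exp (-x * t) * f t * (w * Real.sin (w * t))
    - h' t * (1 - Real.cos (w * t)) with hΨ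
  have hΨd : ∀ t, 0 < t → HasDerivAt Ψ (w ^ 2 * (Real.exp (-x * t) * f t * Real.cos (w * t))
      - Real.exp (-x * t) * (deriv (deriv f) t - 2 * x * deriv f t + x ^ 2 * f t)
        * (1 - Real.cos (w * t))) t := fun t ht => by
    have e1 := (hasDerivAt_exp_neg_mul x t).mul (hf.hasDerivAt ht)
    have e2 := (hasDerivAt_exp_neg_mul x t).mul
      ((hf.hasDerivAt_deriv ht).sub ((hf.hasDerivAt ht).const_mul x))
    exact ((e1.mul ((hasDerivAt_sin_mul w t).const_mul w)).sub
      (e2.mul ((hasDerivAt_cos_mul w t).const_sub 1))).congr_deriv (by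
        simp only [Pi.mul_apply, Pi.sub_apply]; ring)
  have hmain : 0 ≤ ∫ t in Set.Ioi (0 : ℝ), w ^ 2 * (Complex.exp (-p * (t : ℂ)) * (f t : ℂ)).re := by
    refine le_integral_Ioi_of_le
      (r := fun ε => f₀ * (w * (w * ε)) + (2 * f₀ + x * f₀ * ε) * (w ^ 2 * ε / 2))
      (T := fun n : ℕ => (n : ℝ) * (2 * Real.pi / w)) (a := fun _ => 0)
      (hint.re.const_mul (w ^ 2))
      (tendsto_natCast_atTop_atTop.atTop_mul_const (by positivity)) tendsto_const_nhds ?_ ?_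
    · refine tendsto_nhdsWithin_of_tendsto_nhds ?_
      have e : Continuous fun ε : ℝ =>
          f₀ * (w * (w * ε)) + (2 * f₀ + x * f₀ * ε) * (w ^ 2 * ε / 2) := by fun_prop
      simpa using e.tendsto 0
    · intro ε hε n hn
      have hle := intervalIntegral.sub_le_integral_of_hasDeriv_right_of_le
        (g := Ψ) (φ := fun t => w ^ 2 * (Complex.exp (-p * (t : ℂ)) * (f t : ℂ)).re) hn.le
        (fun t ht => (hΨd t (hε.trans_le ht.1)).continuousAt.continuousWithinAt)
        (fun t ht => (hΨd t (hε.trans ht.1)).hasDerivWithinAt)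
        (IntegrableOn.mono_set (hint.re.const_mul (w ^ 2)) fun t ht => hε.trans_le ht.1)
        fun t ht => by
          have ht0 : 0 < t := hε.trans ht.1
          rw [hφ t ht0]
          have i1 := hf.deriv_deriv_nonneg ht0
          have i2 := hf.deriv_nonpos ht0
          have i3 := hf.nonneg ht0
          have i4 := sub_nonneg.2 (Real.cos_le_one (w * t))
          have i5 : 0 ≤ deriv (deriv f) t - 2 * x * deriv f t + x ^ 2 * f t := by
            have : 0 ≤ x * -deriv f t := mul_nonneg hp.le (by linarith)
            have : 0 ≤ x ^ 2 * f t := by positivity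
            linarith
          have := mul_nonneg (mul_nonneg (Real.exp_pos (-x * t)).le i5) i4
          linarith
      -- `T n` is a multiple of the period, so `Ψ` vanishes there
      have hΨT : Ψ ((n : ℝ) * (2 * Real.pi / w)) = 0 := by
        have e : w * ((n : ℝ) * (2 * Real.pi / w)) = (n : ℝ) * (2 * Real.pi) := by field_simp
        have es : Real.sin ((n : ℝ) * (2 * Real.pi)) = 0 := by
          have := Real.sin_nat_mul_pi (n * 2)
          rw [← this]; push_cast; ring_nf
        simp only [hΨ]
        rw [e, Real.cos_nat_mul_two_pi, es]
        ring
      have hΨε : Ψ ε ≤ f₀ * (w * (w * ε)) + (2 * f₀ + x * f₀ * ε) * (w ^ 2 * ε / 2) := by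
        have i1 : Real.exp (-x * ε) ≤ 1 := Real.exp_le_one_iff.2 (by nlinarith)
        have i2 := Real.exp_pos (-x * ε)
        have i3 := hf.nonneg hε
        have i4 := hf.le_limit_zero h0 hε
        have i5 := hf.neg_deriv_le h0 hε
        have i6 := hf.deriv_nonpos hε
        have i7 : Real.sin (w * ε) ≤ w * ε := Real.sin_le (by positivity)
        have i8 : 1 - Real.cos (w * ε) ≤ (w * ε) ^ 2 / 2 := by
          linarith [Real.one_sub_sq_div_two_le_cos (x := w * ε)]
        have i9 := sub_nonneg.2 (Real.cos_le_one (w * ε))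
        have j1 : Real.exp (-x * ε) * f ε * (w * Real.sin (w * ε)) ≤ f₀ * (w * (w * ε)) := by
          have e1 : Real.exp (-x * ε) * f ε ≤ 1 * f₀ := by gcongr
          rw [one_mul] at e1
          calc _ ≤ Real.exp (-x * ε) * f ε * (w * (w * ε)) := by gcongr
            _ ≤ _ := by gcongr
        have j2 : -h' ε ≤ 2 * f₀ / ε + x * f₀ := by
          have e1 : 0 ≤ -deriv f ε + x * f ε := by
            have := mul_nonneg hp.le i3
            linarith
          have e2 : x * f ε ≤ x * f₀ := by gcongr
          calc -h' ε = Real.exp (-x * ε) * (-deriv f ε + x * f ε) := by simp only [hh']; ring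
            _ ≤ 1 * (-deriv f ε + x * f ε) := by gcongr
            _ ≤ _ := by linarith
        have j3 : -h' ε * (1 - Real.cos (w * ε)) ≤ (2 * f₀ / ε + x * f₀) * ((w * ε) ^ 2 / 2) := by
          have : 0 ≤ 2 * f₀ / ε + x * f₀ := by
            have := mul_nonneg hp.le hf₀
            positivity
          calc _ ≤ (2 * f₀ / ε + x * f₀) * (1 - Real.cos (w * ε)) := by gcongr
            _ ≤ _ := by gcongr
        have j4 : (2 * f₀ / ε + x * f₀) * ((w * ε) ^ 2 / 2)
            = (2 * f₀ + x * f₀ * ε) * (w ^ 2 * ε / 2) := by field_simp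
        simp only [hΨ]
        linarith
      rw [hΨT] at hle
      exact le_trans (by linarith) hle
  rw [integral_const_mul] at hmain
  rw [hre]
  exact nonneg_of_mul_nonneg_right hmain (by positivity)

/-! ### Real symmetric matrices -/

open scoped MatrixOrder in
lemma exists_posDef_sq_eq {ι : Type*} [Fintype ι] [DecidableEq ι] {A : Matrix ι ι ℝ}
    (hA : A.PosDef) : ∃ S : Matrix ι ι ℝ, S.PosDef ∧ S * S = A := by
  have h1 : CFC.sqrt A * CFC.sqrt A = A := CFC.sqrt_mul_sqrt_self A hA.posSemidef.nonneg
  have h2 : (CFC.sqrt A).PosSemidef := (CFC.sqrt_nonneg A).posSemidef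
  refine ⟨CFC.sqrt A, h2.posDef_iff_isUnit.2 ?_, h1⟩
  have h3 : IsUnit (CFC.sqrt A * CFC.sqrt A) := by rw [h1]; exact hA.isUnit
  exact isUnit_of_mul_isUnit_left h3

/-- The smallest eigenvalue of a real symmetric matrix exists and bounds its quadratic form from
below. -/
lemma exists_isLeast_eigenvalue {ι : Type*} [Fintype ι] [DecidableEq ι] [Nonempty ι]
    {B : Matrix ι ι ℝ} (hB : B.IsHermitian) :
    ∃ b₀, IsLeast {b : ℝ | Module.End.HasEigenvalue (toLin' B) b} b₀ ∧
      ∀ u : ι → ℝ, b₀ * (u ⬝ᵥ u) ≤ u ⬝ᵥ B *ᵥ u := by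
  have hset : {b : ℝ | Module.End.HasEigenvalue (toLin' B) b} = spectrum ℝ B := by
    ext b
    rw [Set.mem_ofPred_eq, Module.End.hasEigenvalue_iff_mem_spectrum, spectrum_toLin']
  obtain ⟨b₀, hb₀⟩ : ∃ b₀, IsLeast (spectrum ℝ B) b₀ := by
    rw [hB.spectrum_real_eq_range_eigenvalues]
    obtain ⟨i, hi⟩ := Finite.exists_min hB.eigenvalues
    exact ⟨hB.eigenvalues i, ⟨i, rfl⟩, by rintro _ ⟨j, rfl⟩; exact hi j⟩
  refine ⟨b₀, hset ▸ hb₀, fun u => ?_⟩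
  have hherm : (B - b₀ • (1 : Matrix ι ι ℝ)).IsHermitian := by
    refine hB.sub ?_
    rw [IsHermitian, conjTranspose_smul, conjTranspose_one, star_trivial]
  have hpsd : (B - b₀ • (1 : Matrix ι ι ℝ)).PosSemidef := by
    rw [hherm.posSemidef_iff_eigenvalues_nonneg]
    intro i
    have h1 := hherm.eigenvalues_mem_spectrum_real i
    generalize hherm.eigenvalues i = μ at h1 ⊢
    rw [← Algebra.algebraMap_eq_smul_one, ← spectrum.sub_singleton_eq, Set.sub_singleton] at h1
    obtain ⟨z, hz, rfl⟩ := h1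
    exact sub_nonneg.2 (hb₀.2 hz)
  have h1 := hpsd.dotProduct_mulVec_nonneg u
  rw [sub_mulVec, smul_mulVec, one_mulVec, dotProduct_sub, dotProduct_smul, star_trivial,
    smul_eq_mul] at h1
  linarith

/-- For a complex symmetric matrix the form `⟨v, M v⟩` splits into the real and imaginary
parts of `v`. -/
lemma numForm_of_isSymm {ι : Type*} [Fintype ι] [DecidableEq ι] {M : Matrix ι ι ℂ}
    (hM : M.IsSymm) (v : EuclideanSpace ℂ ι) :
    numForm v M = ∑ i, ∑ k, (((v i).re * (v k).re : ℝ) : ℂ) * M i k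
      + ∑ i, ∑ k, (((v i).im * (v k).im : ℝ) : ℂ) * M i k := by
  have h1 : numForm v M = ∑ i, ∑ k, (starRingEnd ℂ (v i)) * v k * M i k := by
    rw [numForm_apply, PiLp.inner_apply]
    refine Finset.sum_congr rfl fun i _ => ?_
    rw [RCLike.inner_apply, ofLp_toEuclideanCLM, mulVec, dotProduct, Finset.sum_mul]
    exact Finset.sum_congr rfl fun k _ => by ring
  have h2 : ∑ i, ∑ k, (((v i).re * (v k).im : ℝ) : ℂ) * M i k
      = ∑ i, ∑ k, (((v i).im * (v k).re : ℝ) : ℂ) * M i k := by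
    rw [Finset.sum_comm]
    refine Finset.sum_congr rfl fun i _ => Finset.sum_congr rfl fun k _ => ?_
    rw [hM.apply, mul_comm (v k).re]
  have h3 : ∀ i k, (starRingEnd ℂ (v i)) * v k * M i k
      = (((v i).re * (v k).re : ℝ) : ℂ) * M i k + (((v i).im * (v k).im : ℝ) : ℂ) * M i k
        + Complex.I * ((((v i).re * (v k).im : ℝ) : ℂ) * M i k)
        - Complex.I * ((((v i).im * (v k).re : ℝ) : ℂ) * M i k) := fun i k => by
    conv_lhs => rw [← Complex.re_add_im (v k), ← Complex.re_add_im (v i)]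
    simp only [map_add, map_mul, Complex.conj_ofReal, Complex.conj_I]
    push_cast
    linear_combination (-((v i).im : ℂ) * (v k).im * M i k) * Complex.I_sq
  rw [h1]
  simp_rw [h3, Finset.sum_sub_distrib, Finset.sum_add_distrib, ← Finset.mul_sum]
  rw [h2]
  ring

lemma norm_sq_eq_re_add_im {ι : Type*} [Fintype ι] (v : EuclideanSpace ℂ ι) :
    ‖v‖ ^ 2 = (fun i => (v i).re) ⬝ᵥ (fun i => (v i).re)
      + (fun i => (v i).im) ⬝ᵥ (fun i => (v i).im) := by
  rw [EuclideanSpace.norm_sq_eq, dotProduct, dotProduct, ← Finset.sum_add_distrib]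
  refine Finset.sum_congr rfl fun i _ => ?_
  rw [← Complex.normSq_eq_norm_sq, Complex.normSq_apply]

lemma dotProduct_mulVec_eq_sum {ι : Type*} [Fintype ι] (M : Matrix ι ι ℝ) (u : ι → ℝ) :
    u ⬝ᵥ M *ᵥ u = ∑ i, ∑ k, u i * u k * M i k := by
  simp only [dotProduct, mulVec, Finset.mul_sum]
  exact Finset.sum_congr rfl fun i _ => Finset.sum_congr rfl fun k _ => by ring

lemma numForm_map_ofReal {ι : Type*} [Fintype ι] [DecidableEq ι] {M : Matrix ι ι ℝ}
    (hM : M.IsSymm) (v : EuclideanSpace ℂ ι) :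
    numForm v (M.map (fun b : ℝ => (b : ℂ)))
      = (((fun i => (v i).re) ⬝ᵥ M *ᵥ (fun i => (v i).re)
        + (fun i => (v i).im) ⬝ᵥ M *ᵥ (fun i => (v i).im) : ℝ) : ℂ) := by
  rw [numForm_of_isSymm (hM.map _), dotProduct_mulVec_eq_sum, dotProduct_mulVec_eq_sum]
  push_cast
  simp only [map_apply]

lemma coercive_map_ofReal {ι : Type*} [Fintype ι] [DecidableEq ι] {M : Matrix ι ι ℝ}
    (hM : M.IsSymm) {b : ℝ} (hb : ∀ u : ι → ℝ, b * (u ⬝ᵥ u) ≤ u ⬝ᵥ M *ᵥ u) :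
    Coercive b (M.map (fun b : ℝ => (b : ℂ))) := fun v => by
  rw [numForm_map_ofReal hM, Complex.ofReal_re, norm_sq_eq_re_add_im, mul_add]
  exact add_le_add (hb _) (hb _)

/-! ### Tensors and the acoustic tensor -/

section Tensor

variable {d : ℕ}

/-- The bilinear form `E_ij H_ijkl F_kl` of a rank-4 tensor. -/
def bilinForm (H : Tensor4 d) (E F : Matrix (Fin d) (Fin d) ℝ) : ℝ :=
  ∑ i, ∑ j, ∑ k, ∑ l, E i j * H i j k l * F k l

lemma quadForm_eq_bilinForm (H : Tensor4 d) (E : Matrix (Fin d) (Fin d) ℝ) :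
    quadForm H E = bilinForm H E E := rfl

lemma bilinForm_add_left (H : Tensor4 d) (E E' F : Matrix (Fin d) (Fin d) ℝ) :
    bilinForm H (E + E') F = bilinForm H E F + bilinForm H E' F := by
  simp only [bilinForm, Matrix.add_apply, add_mul, Finset.sum_add_distrib]

lemma bilinForm_add_right (H : Tensor4 d) (E F F' : Matrix (Fin d) (Fin d) ℝ) :
    bilinForm H E (F + F') = bilinForm H E F + bilinForm H E F' := by
  simp only [bilinForm, Matrix.add_apply, mul_add, Finset.sum_add_distrib]

lemma bilinForm_smul_left (H : Tensor4 d) (a : ℝ) (E F : Matrix (Fin d) (Fin d) ℝ) :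
    bilinForm H (a • E) F = a * bilinForm H E F := by
  simp only [bilinForm, Matrix.smul_apply, smul_eq_mul, Finset.mul_sum, mul_assoc]

lemma bilinForm_smul_right (H : Tensor4 d) (a : ℝ) (E F : Matrix (Fin d) (Fin d) ℝ) :
    bilinForm H E (a • F) = a * bilinForm H E F := by
  simp only [bilinForm, Matrix.smul_apply, smul_eq_mul, Finset.mul_sum]
  refine Finset.sum_congr rfl fun i _ => Finset.sum_congr rfl fun j _ =>
    Finset.sum_congr rfl fun k _ => Finset.sum_congr rfl fun l _ => by ring

lemma bilinForm_single (H : Tensor4 d) (i j k l : Fin d) :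
    bilinForm H (Matrix.single i j 1) (Matrix.single k l 1) = H i j k l := by
  simp only [bilinForm, Matrix.single_apply, ite_and, ite_mul, mul_ite, one_mul, zero_mul, mul_one,
    mul_zero]
  simp

lemma IsSymmetricOperator.bilinForm_transpose_left {H : Tensor4 d} (hH : IsSymmetricOperator H)
    (E F : Matrix (Fin d) (Fin d) ℝ) : bilinForm H Eᵀ F = bilinForm H E F := by
  rw [bilinForm, Finset.sum_comm]
  refine Finset.sum_congr rfl fun i _ => Finset.sum_congr rfl fun j _ =>
    Finset.sum_congr rfl fun k _ => Finset.sum_congr rfl fun l _ => ?_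
  rw [transpose_apply, hH.minor_left j i]

lemma IsSymmetricOperator.bilinForm_symm {H : Tensor4 d} (hH : IsSymmetricOperator H)
    (E F : Matrix (Fin d) (Fin d) ℝ) : bilinForm H E F = bilinForm H F E := by
  have h1 : ∀ E F : Matrix (Fin d) (Fin d) ℝ, bilinForm H E F
      = ∑ x : (Fin d × Fin d) × (Fin d × Fin d), E x.1.1 x.1.2 * H x.1.1 x.1.2 x.2.1 x.2.2
        * F x.2.1 x.2.2 := fun E F => by
    simp only [bilinForm, Fintype.sum_prod_type]
  rw [h1, h1]
  refine Fintype.sum_equiv (Equiv.prodComm _ _) _ _ fun x => ?_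
  simp only [Equiv.prodComm_apply, Prod.fst_swap, Prod.snd_swap]
  rw [hH.major]
  ring

lemma IsSymmetricOperator.bilinForm_transpose_right {H : Tensor4 d} (hH : IsSymmetricOperator H)
    (E F : Matrix (Fin d) (Fin d) ℝ) : bilinForm H E Fᵀ = bilinForm H E F := by
  rw [hH.bilinForm_symm, hH.bilinForm_transpose_left, hH.bilinForm_symm]

/-- Polarization: the components of a symmetric operator from its quadratic form on symmetric
matrices. -/
lemma IsSymmetricOperator.apply_eq {H : Tensor4 d} (hH : IsSymmetricOperator H)
    (i j k l : Fin d) :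
    H i j k l = 16⁻¹ * quadForm H ((Matrix.single i j 1 + (Matrix.single i j 1)ᵀ)
        + (Matrix.single k l 1 + (Matrix.single k l 1)ᵀ))
      + (-16⁻¹) * quadForm H ((Matrix.single i j 1 + (Matrix.single i j 1)ᵀ)
        + (-1 : ℝ) • (Matrix.single k l 1 + (Matrix.single k l 1)ᵀ)) := by
  simp only [quadForm_eq_bilinForm, bilinForm_add_left, bilinForm_add_right, bilinForm_smul_left,
    bilinForm_smul_right, hH.bilinForm_transpose_left, hH.bilinForm_transpose_right]
  rw [hH.bilinForm_symm (Matrix.single k l 1) (Matrix.single i j 1), bilinForm_single,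
    bilinForm_single, bilinForm_single]
  ring

/-- The acoustic (Christoffel) tensor `H_ijkl n_j n_l`. -/
def acoustic (H : Tensor4 d) (n : EuclideanSpace ℝ (Fin d)) : Matrix (Fin d) (Fin d) ℝ :=
  Matrix.of fun i k => ∑ j, ∑ l, H i j k l * n j * n l

/-- The symmetrized product `(u ⊗ n + n ⊗ u) / 2`. -/
noncomputable def symProd (u : Fin d → ℝ) (n : EuclideanSpace ℝ (Fin d)) :
    Matrix (Fin d) (Fin d) ℝ :=
  (2⁻¹ : ℝ) • (Matrix.vecMulVec u n + (Matrix.vecMulVec u n)ᵀ)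

lemma symProd_isSymm (u : Fin d → ℝ) (n : EuclideanSpace ℝ (Fin d)) : (symProd u n).IsSymm :=
  (isSymm_add_transpose_self _).smul _

lemma symProd_ne_zero {u : Fin d → ℝ} (hu : u ≠ 0) {n : EuclideanSpace ℝ (Fin d)} (hn : ‖n‖ = 1) :
    symProd u n ≠ 0 := by
  intro h
  have hn2 : ∑ j, n j * n j = 1 := by
    have := EuclideanSpace.real_norm_sq_eq n
    rw [hn] at this
    simpa [pow_two] using this.symm
  have h1 : ∀ i j, u i * n j + u j * n i = 0 := fun i j => by
    have h2 := congrFun (congrFun h i) j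
    simp only [symProd, Matrix.smul_apply, Matrix.add_apply, transpose_apply, vecMulVec_apply,
      smul_eq_mul, Matrix.zero_apply] at h2
    linarith
  set s := ∑ j, u j * n j with hs
  have h2 : ∀ i, u i + s * n i = 0 := fun i => by
    have h3 : ∑ j, (u i * n j + u j * n i) * n j = 0 :=
      Finset.sum_eq_zero fun j _ => by rw [h1, zero_mul]
    have h4 : ∑ j, (u i * n j + u j * n i) * n j = u i * (∑ j, n j * n j) + s * n i := by
      rw [hs, Finset.mul_sum, Finset.sum_mul, ← Finset.sum_add_distrib]
      exact Finset.sum_congr rfl fun j _ => by ring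
    rw [h4, hn2, mul_one] at h3
    exact h3
  have h5 : s = 0 := by
    have h6 : ∑ i, (u i + s * n i) * n i = 0 :=
      Finset.sum_eq_zero fun i _ => by rw [h2, zero_mul]
    have h7 : ∑ i, (u i + s * n i) * n i = s + s * ∑ i, n i * n i := by
      rw [hs, Finset.mul_sum, ← Finset.sum_add_distrib]
      exact Finset.sum_congr rfl fun j _ => by ring
    rw [h7, hn2] at h6
    linarith
  refine hu (funext fun i => ?_)
  simpa [h5] using h2 i

lemma IsSymmetricOperator.quadForm_symProd {H : Tensor4 d} (hH : IsSymmetricOperator H)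
    (u : Fin d → ℝ) (n : EuclideanSpace ℝ (Fin d)) :
    quadForm H (symProd u n) = u ⬝ᵥ acoustic H n *ᵥ u := by
  have h1 : quadForm H (symProd u n) = bilinForm H (vecMulVec u n) (vecMulVec u n) := by
    simp only [quadForm_eq_bilinForm, symProd, bilinForm_add_left, bilinForm_add_right,
      bilinForm_smul_left, bilinForm_smul_right, hH.bilinForm_transpose_left,
      hH.bilinForm_transpose_right]
    ring
  rw [h1, dotProduct_mulVec_eq_sum, bilinForm]
  refine Finset.sum_congr rfl fun i _ => ?_
  rw [Finset.sum_comm]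
  refine Finset.sum_congr rfl fun k _ => ?_
  simp only [acoustic, of_apply, vecMulVec_apply, Finset.mul_sum]
  refine Finset.sum_congr rfl fun j _ => Finset.sum_congr rfl fun l _ => by ring

lemma IsSymmetricOperator.acoustic_isSymm {H : Tensor4 d} (hH : IsSymmetricOperator H)
    (n : EuclideanSpace ℝ (Fin d)) : (acoustic H n).IsSymm := by
  refine IsSymm.ext fun i k => ?_
  simp only [acoustic, of_apply]
  rw [Finset.sum_comm]
  refine Finset.sum_congr rfl fun j _ => Finset.sum_congr rfl fun l _ => ?_
  rw [hH.major]
  ring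

lemma IsSymmetricOperator.acoustic_posDef {H : Tensor4 d} (hH : IsSymmetricOperator H)
    (hpos : PositiveDefinite H) {n : EuclideanSpace ℝ (Fin d)} (hn : ‖n‖ = 1) :
    (acoustic H n).PosDef := by
  refine PosDef.of_dotProduct_mulVec_pos ?_ fun u hu => ?_
  · rw [IsHermitian, conjTranspose_eq_transpose_of_trivial]
    exact hH.acoustic_isSymm n
  · rw [star_trivial, ← hH.quadForm_symProd]
    exact hpos _ (symProd_isSymm u n) (symProd_ne_zero hu hn)

lemma tendsto_apply {l : Filter ℝ} {G : ℝ → Tensor4 d} {H : Tensor4 d} (h : Tendsto G l (𝓝 H))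
    (i j k m : Fin d) : Tendsto (fun s => G s i j k m) l (𝓝 (H i j k m)) :=
  tendsto_pi_nhds.1 (tendsto_pi_nhds.1 (tendsto_pi_nhds.1 (tendsto_pi_nhds.1 h i) j) k) m

lemma tendsto_quadForm {l : Filter ℝ} {G : ℝ → Tensor4 d} {H : Tensor4 d} (h : Tendsto G l (𝓝 H))
    (E : Matrix (Fin d) (Fin d) ℝ) :
    Tendsto (fun s => quadForm (G s) E) l (𝓝 (quadForm H E)) :=
  tendsto_finsetSum _ fun i _ => tendsto_finsetSum _ fun j _ => tendsto_finsetSum _ fun k _ =>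
    tendsto_finsetSum _ fun m _ => ((tendsto_apply h i j k m).const_mul _).mul_const _

lemma isSymmetricOperator_of_tendsto {l : Filter ℝ} [l.NeBot] {G : ℝ → Tensor4 d} {H : Tensor4 d}
    (h : Tendsto G l (𝓝 H)) (hG : ∀ᶠ s in l, IsSymmetricOperator (G s)) :
    IsSymmetricOperator H where
  minor_left i j k m := tendsto_nhds_unique ((tendsto_apply h i j k m).congr'
    (hG.mono fun _ hs => hs.minor_left i j k m)) (tendsto_apply h j i k m)
  minor_right i j k m := tendsto_nhds_unique ((tendsto_apply h i j k m).congr'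
    (hG.mono fun _ hs => hs.minor_right i j k m)) (tendsto_apply h i j m k)
  major i j k m := tendsto_nhds_unique ((tendsto_apply h i j k m).congr'
    (hG.mono fun _ hs => hs.major i j k m)) (tendsto_apply h k m i j)

end Tensor

/-! ### The matrix `Q_n(p)` of a relaxation modulus -/

section Modulus

variable {d : ℕ} {G : ℝ → Tensor4 d}

lemma IsRelaxationModulus.isBddCont_quadForm (hG : IsRelaxationModulus G)
    {E : Matrix (Fin d) (Fin d) ℝ} (hE : E.IsSymm) : IsBddCont fun s => quadForm (G s) E := by
  obtain ⟨G₀, hG₀⟩ := hG.finite_limit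
  exact (hG.completelyMonotonic E hE).isBddCont (tendsto_quadForm hG₀ E)

lemma IsRelaxationModulus.isBddCont_apply (hG : IsRelaxationModulus G) (i j k l : Fin d) :
    IsBddCont fun s => G s i j k l := by
  have h1 : ∀ i j : Fin d,
      (Matrix.single i j (1 : ℝ) + (Matrix.single i j (1 : ℝ))ᵀ).IsSymm := fun i j =>
    isSymm_add_transpose_self _
  refine (((hG.isBddCont_quadForm ((h1 i j).add (h1 k l))).const_mul _).add
    ((hG.isBddCont_quadForm ((h1 i j).add ((h1 k l).smul (-1 : ℝ)))).const_mul _)).congr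
    fun t ht => (hG.symmetric t ht).apply_eq i j k l

lemma acoustic_apply_eq (H : Tensor4 d) (n : EuclideanSpace ℝ (Fin d)) (i k : Fin d) :
    acoustic H n i k = ∑ j, ∑ l, n j * n l * H i j k l := by
  simp only [acoustic, of_apply]
  exact Finset.sum_congr rfl fun j _ => Finset.sum_congr rfl fun l _ => by ring

lemma IsRelaxationModulus.isBddCont_acoustic (hG : IsRelaxationModulus G)
    (n : EuclideanSpace ℝ (Fin d)) (i k : Fin d) : IsBddCont fun s => acoustic (G s) n i k := by
  simp_rw [acoustic_apply_eq]
  exact .sum _ fun j _ => .sum _ fun l _ => (hG.isBddCont_apply i j k l).const_mul _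

lemma IsRelaxationModulus.Qn_apply (hG : IsRelaxationModulus G) (n : EuclideanSpace ℝ (Fin d))
    {p : ℂ} (hp : 0 < p.re) (i k : Fin d) :
    Qn G n p i k = p * laplace (fun s => acoustic (G s) n i k) p := by
  simp_rw [acoustic_apply_eq]
  rw [laplace_sum _ (fun j _ => .sum _ fun l _ => (hG.isBddCont_apply i j k l).const_mul _) hp,
    Finset.mul_sum]
  simp only [Qn, of_apply]
  refine Finset.sum_congr rfl fun j _ => ?_
  rw [laplace_sum _ (fun l _ => (hG.isBddCont_apply i j k l).const_mul _) hp, Finset.mul_sum]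
  refine Finset.sum_congr rfl fun l _ => ?_
  rw [laplace_const_mul, Q, laplace]
  push_cast
  ring

lemma IsRelaxationModulus.laplace_quadForm (hG : IsRelaxationModulus G)
    (n : EuclideanSpace ℝ (Fin d)) {p : ℂ} (hp : 0 < p.re) (u : Fin d → ℝ) :
    laplace (fun s => quadForm (G s) (symProd u n)) p
      = ∑ i, ∑ k, ((u i * u k : ℝ) : ℂ) * laplace (fun s => acoustic (G s) n i k) p := by
  have h1 : ∀ t, 0 < t → quadForm (G t) (symProd u n)
      = ∑ i, ∑ k, u i * u k * acoustic (G t) n i k := fun t ht => by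
    rw [(hG.symmetric t ht).quadForm_symProd, dotProduct_mulVec_eq_sum]
  rw [laplace_congr h1,
    laplace_sum _ (fun i _ => .sum _ fun k _ => (hG.isBddCont_acoustic n i k).const_mul _) hp]
  refine Finset.sum_congr rfl fun i _ => ?_
  rw [laplace_sum _ (fun k _ => (hG.isBddCont_acoustic n i k).const_mul _) hp]
  exact Finset.sum_congr rfl fun k _ => laplace_const_mul _ _ _

/-- The form of `Q_n(p)` in terms of the scalar functions `u ↦ ⟨u ⊗ n, G u ⊗ n⟩`, to which complete
monotonicity applies. -/
lemma IsRelaxationModulus.numForm_Qn (hG : IsRelaxationModulus G) (n : EuclideanSpace ℝ (Fin d))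
    {p : ℂ} (hp : 0 < p.re) (v : EuclideanSpace ℂ (Fin d)) :
    numForm v (Qn G n p)
      = p * (laplace (fun s => quadForm (G s) (symProd (fun i => (v i).re) n)) p
        + laplace (fun s => quadForm (G s) (symProd (fun i => (v i).im) n)) p) := by
  have hsymm : (Qn G n p).IsSymm := IsSymm.ext fun i k => by
    rw [hG.Qn_apply n hp, hG.Qn_apply n hp]
    congr 1
    exact laplace_congr (fun t ht => ((hG.symmetric t ht).acoustic_isSymm n).apply i k) p
  rw [numForm_of_isSymm hsymm, hG.laplace_quadForm n hp, hG.laplace_quadForm n hp, mul_add,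
    Finset.mul_sum, Finset.mul_sum]
  simp_rw [Finset.mul_sum, hG.Qn_apply n hp]
  congr 1 <;>
  exact Finset.sum_congr rfl fun i _ => Finset.sum_congr rfl fun k _ => by ring

lemma IsRelaxationModulus.re_conj_mul_numForm_Qn_nonneg (hG : IsRelaxationModulus G)
    (n : EuclideanSpace ℝ (Fin d)) {p : ℂ} (hp : 0 < p.re) (v : EuclideanSpace ℂ (Fin d)) :
    0 ≤ ((starRingEnd ℂ) p * numForm v (Qn G n p)).re := by
  obtain ⟨G₀, hG₀⟩ := hG.finite_limit
  rw [hG.numForm_Qn n hp, ← mul_assoc, mul_comm _ p, Complex.mul_conj, Complex.re_ofReal_mul,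
    Complex.add_re]
  have h1 : ∀ u : Fin d → ℝ, 0 ≤ (laplace (fun s => quadForm (G s) (symProd u n)) p).re := fun u =>
    (hG.completelyMonotonic _ (symProd_isSymm u n)).re_laplace_nonneg (tendsto_quadForm hG₀ _) hp
  exact mul_nonneg (Complex.normSq_nonneg p) (add_nonneg (h1 _) (h1 _))

lemma nonempty_of_norm_eq_one {n : EuclideanSpace ℝ (Fin d)} (hn : ‖n‖ = 1) : Nonempty (Fin d) := by
  by_contra h
  rw [not_nonempty_iff] at h
  rw [Subsingleton.elim n 0, norm_zero] at hn
  exact zero_ne_one hn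

lemma exists_pos_le_dotProduct {A : Matrix (Fin d) (Fin d) ℝ} (hA : A.PosDef)
    (hd : Nonempty (Fin d)) :
    ∃ b₀, IsLeast {b : ℝ | Module.End.HasEigenvalue (toLin' A) b} b₀ ∧ 0 < b₀ ∧
      ∀ u : Fin d → ℝ, b₀ * (u ⬝ᵥ u) ≤ u ⬝ᵥ A *ᵥ u := by
  obtain ⟨b₀, hb₀, hle⟩ := exists_isLeast_eigenvalue hA.isHermitian
  refine ⟨b₀, hb₀, ?_, hle⟩
  obtain ⟨u, hu⟩ := (hb₀.1 : Module.End.HasEigenvalue (toLin' A) b₀).exists_hasEigenvector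
  have h1 := hA.dotProduct_mulVec_pos hu.2
  have h2 : A *ᵥ u = b₀ • u := by simpa using hu.apply_eq_smul
  rw [star_trivial, h2, dotProduct_smul, smul_eq_mul] at h1
  exact pos_of_mul_pos_left h1 (dotProduct_self_star_nonneg u)

lemma IsRelaxationModulus.exists_coercive_Qn (hG : IsRelaxationModulus G)
    {n : EuclideanSpace ℝ (Fin d)} (hn : ‖n‖ = 1) :
    ∃ c, 0 < c ∧ ∀ p : ℂ, 0 < p.re → Coercive c (Qn G n p) := by
  obtain ⟨G₀, hG₀⟩ := hG.finite_limit
  obtain ⟨G_inf, hG_inf, hpos⟩ := hG.solid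
  have hsym : IsSymmetricOperator G_inf := isSymmetricOperator_of_tendsto hG_inf
    ((eventually_gt_atTop 0).mono fun s hs => hG.symmetric s hs)
  obtain ⟨c, -, hc, hle⟩ := exists_pos_le_dotProduct (hsym.acoustic_posDef hpos hn)
    (nonempty_of_norm_eq_one hn)
  refine ⟨c, hc, fun p hp v => ?_⟩
  have h1 : ∀ u : Fin d → ℝ, c * (u ⬝ᵥ u)
      ≤ (p * laplace (fun s => quadForm (G s) (symProd u n)) p).re := fun u => by
    refine (hle u).trans ?_
    rw [← hsym.quadForm_symProd]
    exact (hG.completelyMonotonic _ (symProd_isSymm u n)).le_re_mul_laplace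
      (tendsto_quadForm hG₀ _) (tendsto_quadForm hG_inf _) hp
  rw [hG.numForm_Qn n hp, norm_sq_eq_re_add_im, mul_add, mul_add, Complex.add_re]
  exact add_le_add (h1 _) (h1 _)

/-- The limit of the modulus at `0+` dominates the one at infinity. -/
lemma IsRelaxationModulus.positiveDefinite_limit_zero (hG : IsRelaxationModulus G) {G₀ : Tensor4 d}
    (hG₀ : Tendsto G (𝓝[>] 0) (𝓝 G₀)) : PositiveDefinite G₀ := fun E hE hE0 => by
  obtain ⟨G_inf, hG_inf, hpos⟩ := hG.solid
  have hcm := hG.completelyMonotonic E hE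
  refine (hpos E hE hE0).trans_le (le_of_tendsto (tendsto_quadForm hG_inf E) ?_)
  filter_upwards [eventually_gt_atTop 0] with s hs
  exact hcm.le_limit_zero (tendsto_quadForm hG₀ E) hs

lemma differentiableAt_matrix {M : ℂ → Matrix (Fin d) (Fin d) ℂ} {p : ℂ}
    (h : ∀ i k, DifferentiableAt ℂ (fun p => M p i k) p) : DifferentiableAt ℂ M p := by
  have h1 : M = fun p => ∑ i, ∑ k, M p i k • Matrix.single i k (1 : ℂ) := by
    funext p
    conv_lhs => rw [matrix_eq_sum_single (M p)]
    simp [smul_single]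
  rw [h1]
  exact DifferentiableAt.fun_sum fun i _ => DifferentiableAt.fun_sum fun k _ =>
    (h i k).smul_const _

lemma tendsto_matrix {α : Type*} {l : Filter α} {M : α → Matrix (Fin d) (Fin d) ℂ}
    {M₀ : Matrix (Fin d) (Fin d) ℂ} (h : ∀ i k, Tendsto (fun a => M a i k) l (𝓝 (M₀ i k))) :
    Tendsto M l (𝓝 M₀) :=
  tendsto_pi_nhds.2 fun i => tendsto_pi_nhds.2 fun k => h i k

lemma IsRelaxationModulus.differentiableAt_Qn (hG : IsRelaxationModulus G)
    (n : EuclideanSpace ℝ (Fin d)) {p : ℂ} (hp : 0 < p.re) :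
    DifferentiableAt ℂ (Qn G n) p := by
  refine differentiableAt_matrix fun i k => ?_
  have h1 : DifferentiableAt ℂ (fun p => p * laplace (fun s => acoustic (G s) n i k) p) p :=
    differentiableAt_id.mul ((hG.isBddCont_acoustic n i k).differentiableAt_laplace hp)
  refine h1.congr_of_eventuallyEq ?_
  filter_upwards [(isOpen_lt continuous_const Complex.continuous_re).mem_nhds hp] with q hq
  exact hG.Qn_apply n hq i k

lemma IsRelaxationModulus.tendsto_Qn (hG : IsRelaxationModulus G) {G₀ : Tensor4 d}
    (hG₀ : Tendsto G (𝓝[>] 0) (𝓝 G₀)) (n : EuclideanSpace ℝ (Fin d)) :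
    Tendsto (fun x : ℝ => Qn G n x) atTop (𝓝 ((acoustic G₀ n).map fun b : ℝ => (b : ℂ))) := by
  refine tendsto_matrix fun i k => ?_
  have h1 : Tendsto (fun s => acoustic (G s) n i k) (𝓝[>] 0) (𝓝 (acoustic G₀ n i k)) := by
    simp only [acoustic_apply_eq]
    exact tendsto_finsetSum _ fun j _ => tendsto_finsetSum _ fun l _ =>
      (tendsto_apply hG₀ i j k l).const_mul _
  refine ((hG.isBddCont_acoustic n i k).tendsto_mul_laplace h1).congr' ?_
  filter_upwards [eventually_gt_atTop (0 : ℝ)] with x hx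
  exact (hG.Qn_apply n (by simpa using hx) i k).symm

end Modulus

/-! ### The plane-wave integrand -/

section PlaneWave

variable {d : ℕ}

lemma norm_apply_le_norm (M : Matrix (Fin d) (Fin d) ℂ) (i k : Fin d) : ‖M i k‖ ≤ ‖M‖ := by
  have h1 := (toEuclideanCLM (n := Fin d) (𝕜 := ℂ) M).le_opNorm (EuclideanSpace.single k (1 : ℂ))
  rw [l2_opNorm_toEuclideanCLM, PiLp.norm_single, norm_one, mul_one] at h1
  refine le_trans ?_ h1
  have h2 := PiLp.norm_apply_le
    (toEuclideanCLM (n := Fin d) (𝕜 := ℂ) M (EuclideanSpace.single k (1 : ℂ))) i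
  rwa [ofLp_toEuclideanCLM, PiLp.ofLp_single, mulVec_single_one] at h2

variable {ρ : ℝ} {G : ℝ → Tensor4 d} {n : EuclideanSpace ℝ (Fin d)} {c : ℝ}

lemma Kn_eq (hc : 0 < c) {p : ℂ} (h : Coercive c (Qn G n p)) :
    Kn ρ G n p = ((Real.sqrt ρ : ℂ) * p) • invSqrt (Qn G n p) := by
  rw [Kn, h.inv_principalSqrt hc]

lemma inv_Qn_mul_inv_Kn (hρ : 0 < ρ) (hc : 0 < c) {p : ℂ} (hp : 0 < p.re)
    (h : Coercive c (Qn G n p)) :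
    (Qn G n p)⁻¹ * (Kn ρ G n p)⁻¹ = ((Real.sqrt ρ : ℂ) * p)⁻¹ • invSqrt (Qn G n p) := by
  have hp0 : p ≠ 0 := fun h0 => by simp [h0] at hp
  have hne : (Real.sqrt ρ : ℂ) * p ≠ 0 :=
    mul_ne_zero (by exact_mod_cast (Real.sqrt_pos.2 hρ).ne') hp0
  have h1 : (Kn ρ G n p)⁻¹ = ((Real.sqrt ρ : ℂ) * p)⁻¹ • (Qn G n p * invSqrt (Qn G n p)) := by
    refine inv_eq_right_inv ?_
    rw [Kn_eq hc h, smul_mul_smul_comm, h.invSqrt_mul_mul_invSqrt hc, mul_inv_cancel₀ hne, one_smul]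
  rw [h1, mul_smul_comm, ← mul_assoc, nonsing_inv_mul _ (h.isUnit_det hc), one_mul]

lemma IsRelaxationModulus.differentiableAt_invSqrt_Qn (hG : IsRelaxationModulus G) (hc : 0 < c)
    (hQ : ∀ p : ℂ, 0 < p.re → Coercive c (Qn G n p)) {p : ℂ} (hp : 0 < p.re) :
    DifferentiableAt ℂ (fun p => invSqrt (Qn G n p)) p :=
  ((hQ p hp).hasFDerivAt_invSqrt hc).differentiableAt.comp p (hG.differentiableAt_Qn n hp)

lemma IsRelaxationModulus.differentiableAt_Kn (hG : IsRelaxationModulus G) (hc : 0 < c)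
    (hQ : ∀ p : ℂ, 0 < p.re → Coercive c (Qn G n p)) {p : ℂ} (hp : 0 < p.re) :
    DifferentiableAt ℂ (Kn ρ G n) p := by
  have h1 : DifferentiableAt ℂ (fun p : ℂ => ((Real.sqrt ρ : ℂ) * p) • invSqrt (Qn G n p)) p :=
    (differentiableAt_id.const_mul _).smul (hG.differentiableAt_invSqrt_Qn hc hQ hp)
  refine h1.congr_of_eventuallyEq ?_
  filter_upwards [(isOpen_lt continuous_const Complex.continuous_re).mem_nhds hp] with q hq
  exact Kn_eq hc (hQ q hq)

/-- `K_n(p)` is accretive for `Re p > 0`. -/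
lemma IsRelaxationModulus.re_numForm_Kn_nonneg (hG : IsRelaxationModulus G) (hc : 0 < c)
    (hQ : ∀ p : ℂ, 0 < p.re → Coercive c (Qn G n p)) {p : ℂ} (hp : 0 < p.re)
    (v : EuclideanSpace ℂ (Fin d)) : 0 ≤ (numForm v (Kn ρ G n p)).re := by
  rw [Kn_eq hc (hQ p hp), mul_smul, map_smul, smul_eq_mul, Complex.re_ofReal_mul]
  exact mul_nonneg (Real.sqrt_nonneg ρ) ((hQ p hp).re_numForm_smul_invSqrt_nonneg hc hp.le
    (fun u => hG.re_conj_mul_numForm_Qn_nonneg n hp u) v)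

/-- `p⁻¹ K_n(p)` converges to a real positive definite matrix, the inverse square root of the
acoustic tensor of `G(0+)` up to the factor `ρ^{1/2}`. -/
lemma IsRelaxationModulus.exists_tendsto_inv_smul_Kn (hρ : 0 < ρ) (hG : IsRelaxationModulus G)
    (hn : ‖n‖ = 1) (hc : 0 < c) (hQ : ∀ p : ℂ, 0 < p.re → Coercive c (Qn G n p)) :
    ∃ B : Matrix (Fin d) (Fin d) ℝ, B.PosDef ∧
      Tendsto (fun p : ℝ => ((p : ℂ)⁻¹) • Kn ρ G n (p : ℂ)) atTop
        (𝓝 (B.map (fun b : ℝ => (b : ℂ)))) := by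
  have hd := nonempty_of_norm_eq_one hn
  obtain ⟨G₀, hG₀⟩ := hG.finite_limit
  have hsym : IsSymmetricOperator G₀ := isSymmetricOperator_of_tendsto hG₀
    (by filter_upwards [self_mem_nhdsWithin] with s hs using hG.symmetric s hs)
  have hpd := hsym.acoustic_posDef (hG.positiveDefinite_limit_zero hG₀) hn
  set A := acoustic G₀ n with hA
  obtain ⟨a, -, ha, hale⟩ := exists_pos_le_dotProduct hpd hd
  have hAc : Coercive a (A.map fun b : ℝ => (b : ℂ)) :=
    coercive_map_ofReal (hsym.acoustic_isSymm n) hale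
  obtain ⟨S, hS, hSA⟩ := exists_posDef_sq_eq hpd
  obtain ⟨s, -, hs, hsle⟩ := exists_pos_le_dotProduct hS hd
  have hSsymm : S.IsSymm := by
    have := hS.isHermitian
    rwa [IsHermitian, conjTranspose_eq_transpose_of_trivial] at this
  have hSc : Coercive s (S.map fun b : ℝ => (b : ℂ)) := coercive_map_ofReal hSsymm hsle
  have hmul : ∀ M N : Matrix (Fin d) (Fin d) ℝ, (M * N).map (fun b : ℝ => (b : ℂ))
      = M.map (fun b : ℝ => (b : ℂ)) * N.map (fun b : ℝ => (b : ℂ)) := fun M N =>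
    Matrix.map_mul (f := Complex.ofRealHom)
  have hroot : IsPrincipalSqrt (A.map fun b : ℝ => (b : ℂ)) (S.map fun b : ℝ => (b : ℂ)) :=
    ⟨by rw [← hmul, hSA], fun z hz => re_spectrum_pos_of_numForm_pos
      (fun v hv => lt_of_lt_of_le (mul_pos hs (by positivity)) (hSc v)) hz⟩
  have hinv : invSqrt (A.map fun b : ℝ => (b : ℂ)) = S⁻¹.map fun b : ℝ => (b : ℂ) := by
    rw [← hAc.inv_principalSqrt ha, principalSqrt_eq hroot]
    refine inv_eq_right_inv ?_
    rw [← hmul, mul_nonsing_inv _ ((isUnit_iff_isUnit_det S).1 hS.isUnit)]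
    exact Matrix.map_one _ Complex.ofReal_zero Complex.ofReal_one
  refine ⟨Real.sqrt ρ • S⁻¹, hS.inv.smul (Real.sqrt_pos.2 hρ), ?_⟩
  have h1 : (Real.sqrt ρ • S⁻¹).map (fun b : ℝ => (b : ℂ))
      = (Real.sqrt ρ : ℂ) • invSqrt (A.map fun b : ℝ => (b : ℂ)) := by
    rw [hinv]
    ext i k
    simp
  rw [h1]
  have h2 : Tendsto (fun x : ℝ => invSqrt (Qn G n (x : ℂ))) atTop
      (𝓝 (invSqrt (A.map fun b : ℝ => (b : ℂ)))) :=
    (hAc.hasFDerivAt_invSqrt ha).continuousAt.tendsto.comp (hG.tendsto_Qn hG₀ n)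
  refine (h2.const_smul (Real.sqrt ρ : ℂ)).congr' ?_
  filter_upwards [eventually_gt_atTop (0 : ℝ)] with x hx
  have hxc : (x : ℂ) ≠ 0 := by exact_mod_cast hx.ne'
  rw [Kn_eq hc (hQ x (by simpa using hx)), smul_smul, mul_comm (Real.sqrt ρ : ℂ),
    inv_mul_cancel_left₀ hxc]

/-- The bound `Re K_n(p) ≥ b₀ Re p`: Julia's lemma for the functions `p ↦ ⟨v, K_n(p) v⟩`. -/
lemma IsRelaxationModulus.coercive_Kn (hG : IsRelaxationModulus G) (hc : 0 < c)
    (hQ : ∀ p : ℂ, 0 < p.re → Coercive c (Qn G n p)) {B : Matrix (Fin d) (Fin d) ℝ} (hB : B.IsSymm)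
    (hlim : Tendsto (fun p : ℝ => ((p : ℂ)⁻¹) • Kn ρ G n (p : ℂ)) atTop
      (𝓝 (B.map (fun b : ℝ => (b : ℂ))))) {b₀ : ℝ} (hb₀ : 0 < b₀)
    (hle : ∀ u : Fin d → ℝ, b₀ * (u ⬝ᵥ u) ≤ u ⬝ᵥ B *ᵥ u) {p : ℂ} (hp : 0 < p.re) :
    Coercive (b₀ * p.re) (Kn ρ G n p) := fun v => by
  rcases eq_or_ne v 0 with rfl | hv
  · simp [numForm_apply]
  have hBc := coercive_map_ofReal hB hle v
  have hreal := numForm_map_ofReal hB v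
  set β := (fun i => (v i).re) ⬝ᵥ B *ᵥ (fun i => (v i).re)
    + (fun i => (v i).im) ⬝ᵥ B *ᵥ (fun i => (v i).im) with hβ
  rw [hreal, Complex.ofReal_re] at hBc
  have hβ0 : 0 < β := lt_of_lt_of_le (mul_pos hb₀ (by positivity)) hBc
  have hf : DifferentiableOn ℂ (fun p => numForm v (Kn ρ G n p)) {z | 0 < z.re} := fun q hq =>
    ((numForm v).differentiableAt.comp q
      (hG.differentiableAt_Kn hc hQ hq)).differentiableWithinAt
  have hflim : Tendsto (fun x : ℝ => (x : ℂ)⁻¹ * numForm v (Kn ρ G n x)) atTop (𝓝 (β : ℂ)) := by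
    have h1 := ((numForm v).continuous.tendsto _).comp hlim
    rw [hreal] at h1
    simpa [Function.comp_def] using h1
  have h2 := julia_halfPlane hf (fun q hq => hG.re_numForm_Kn_nonneg hc hQ hq v) hβ0 hflim hp
  calc b₀ * p.re * ‖v‖ ^ 2 = b₀ * ‖v‖ ^ 2 * p.re := by ring
    _ ≤ β * p.re := by gcongr
    _ ≤ _ := h2

lemma differentiableAt_apply {M : ℂ → Matrix (Fin d) (Fin d) ℂ} {p : ℂ}
    (h : DifferentiableAt ℂ M p) (i k : Fin d) : DifferentiableAt ℂ (fun p => M p i k) p := by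
  have h1 : DifferentiableAt ℂ (LinearMap.toContinuousLinearMap (entryLinearMap ℂ ℂ i k)) (M p) :=
    ContinuousLinearMap.differentiableAt _
  exact h1.comp p h

lemma IsRelaxationModulus.differentiableAt_planeWaveIntegrand (hρ : 0 < ρ)
    (hG : IsRelaxationModulus G) (hc : 0 < c) (hQ : ∀ p : ℂ, 0 < p.re → Coercive c (Qn G n p))
    (t y : ℝ) {p : ℂ} (hp : 0 < p.re) :
    DifferentiableAt ℂ (planeWaveIntegrand ρ G n t y) p := by
  have hp0 : p ≠ 0 := fun h0 => by simp [h0] at hp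
  have hne : (Real.sqrt ρ : ℂ) * p ≠ 0 :=
    mul_ne_zero (by exact_mod_cast (Real.sqrt_pos.2 hρ).ne') hp0
  have hKy : DifferentiableAt ℂ (fun p => (-(|y| : ℝ) : ℂ) • Kn ρ G n p) p :=
    (hG.differentiableAt_Kn hc hQ hp).const_smul (-(|y| : ℝ) : ℂ)
  have hexp : DifferentiableAt ℂ
      (fun p => NormedSpace.exp ((-(|y| : ℝ) : ℂ) • Kn ρ G n p)) p :=
    (NormedSpace.exp_analytic (𝕂 := ℂ) _).differentiableAt.comp p hKy
  have hinv : DifferentiableAt ℂ (fun p : ℂ => ((Real.sqrt ρ : ℂ) * p)⁻¹) p :=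
    (differentiableAt_id.const_mul (Real.sqrt ρ : ℂ)).inv hne
  have hexpt : DifferentiableAt ℂ (fun p : ℂ => Complex.exp (p * (t : ℂ))) p :=
    (differentiableAt_id.mul_const (t : ℂ)).cexp
  have h0 : DifferentiableAt ℂ
      (fun p : ℂ => ((Real.sqrt ρ : ℂ) * p)⁻¹ • invSqrt (Qn G n p)) p :=
    hinv.smul (hG.differentiableAt_invSqrt_Qn hc hQ hp)
  have h1 : DifferentiableAt ℂ (fun p => Complex.exp (p * (t : ℂ)) •
      (((Real.sqrt ρ : ℂ) * p)⁻¹ • invSqrt (Qn G n p)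
        * NormedSpace.exp ((-(|y| : ℝ) : ℂ) • Kn ρ G n p))) p :=
    hexpt.smul (h0.mul hexp)
  refine h1.congr_of_eventuallyEq ?_
  filter_upwards [(isOpen_lt continuous_const Complex.continuous_re).mem_nhds hp] with q hq
  rw [planeWaveIntegrand, inv_Qn_mul_inv_Kn hρ hc hq (hQ q hq)]

/-- Beyond the wave front the integrand decays exponentially in `Re p`, so that the Bromwich
integral vanishes. -/
lemma IsRelaxationModulus.planeWave_bromwich (hρ : 0 < ρ) (hG : IsRelaxationModulus G)
    (hc : 0 < c) (hQ : ∀ p : ℂ, 0 < p.re → Coercive c (Qn G n p)) {b₀ : ℝ}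
    (hK : ∀ p : ℂ, 0 < p.re → Coercive (b₀ * p.re) (Kn ρ G n p)) {t y : ℝ} (hty : t < b₀ * |y|)
    {σ : ℝ} (hσ : 0 < σ) (i k : Fin d) :
    (∀ R : ℝ, IntervalIntegrable (fun τ : ℝ => planeWaveIntegrand ρ G n t y
      ((σ : ℂ) + (τ : ℂ) * Complex.I) i k) volume (-R) R) ∧
    Tendsto (segmentIntegral σ fun p => planeWaveIntegrand ρ G n t y p i k) atTop (𝓝 0) := by
  have hdiff : DifferentiableOn ℂ (fun p => planeWaveIntegrand ρ G n t y p i k)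
      {p | 0 < p.re} := fun p hp =>
    (differentiableAt_apply (hG.differentiableAt_planeWaveIntegrand hρ hc hQ t y hp)
      i k).differentiableWithinAt
  set N := Real.pi⁻¹ * ∫ s : ℝ, (s ^ 2 + c)⁻¹ with hN
  have hbound : ∀ p : ℂ, 0 < p.re → ‖planeWaveIntegrand ρ G n t y p i k‖
      ≤ (Real.sqrt ρ)⁻¹ * N * Real.exp (-(b₀ * |y| - t) * p.re) / ‖p‖ := fun p hp => by
    refine (norm_apply_le_norm _ i k).trans ?_
    rw [planeWaveIntegrand, inv_Qn_mul_inv_Kn hρ hc hp (hQ p hp), norm_smul, Complex.norm_exp,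
      Complex.re_mul_ofReal]
    have h1 := (hK p hp).norm_exp_le (abs_nonneg y)
    have h2 := (hQ p hp).norm_invSqrt_le hc
    have h3 : ‖((Real.sqrt ρ : ℂ) * p)⁻¹‖ = (Real.sqrt ρ)⁻¹ * ‖p‖⁻¹ := by
      rw [norm_inv, norm_mul, Complex.norm_real, Real.norm_of_nonneg (Real.sqrt_nonneg ρ), mul_inv]
    calc _ ≤ Real.exp (p.re * t) * (‖((Real.sqrt ρ : ℂ) * p)⁻¹ • invSqrt (Qn G n p)‖
          * ‖NormedSpace.exp ((-(|y| : ℝ) : ℂ) • Kn ρ G n p)‖) := by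
            gcongr; exact norm_mul_le _ _
      _ ≤ Real.exp (p.re * t) * ((Real.sqrt ρ)⁻¹ * ‖p‖⁻¹ * N
          * Real.exp (-(b₀ * p.re * |y|))) := by
            rw [norm_smul, h3]
            gcongr
      _ = (Real.sqrt ρ)⁻¹ * N * (Real.exp (p.re * t) * Real.exp (-(b₀ * p.re * |y|))) / ‖p‖ := by
            ring
      _ = _ := by rw [← Real.exp_add]; ring_nf
  have hN0 : 0 ≤ N := mul_nonneg (by positivity) (integral_nonneg fun s => by positivity)
  exact ⟨fun R => intervalIntegrable_vertical hdiff hσ _ _,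
    tendsto_segmentIntegral_zero hdiff (by positivity) (sub_pos.2 hty) hbound hσ⟩

end PlaneWave

end Viscoelastic

open Viscoelastic in
theorem mainTheorem4 {d : ℕ} (ρ : ℝ) (hρ : 0 < ρ)
    (G : ℝ → Viscoelastic.Tensor4 d) (hG : Viscoelastic.IsRelaxationModulus G)
    (n : EuclideanSpace ℝ (Fin d)) (hn : ‖n‖ = 1) :
    ∃ (B : Matrix (Fin d) (Fin d) ℝ) (b₀ : ℝ),
      Tendsto (fun p : ℝ => ((p : ℂ)⁻¹) • Viscoelastic.Kn ρ G n (p : ℂ)) atTop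
        (𝓝 (B.map (fun b : ℝ => (b : ℂ)))) ∧
      B.PosDef ∧
      IsLeast {b : ℝ | Module.End.HasEigenvalue (Matrix.toLin' B) b} b₀ ∧
      0 < b₀ ∧
      ∀ σ : ℝ, 0 < σ →
        (∀ (t : ℝ) (x : EuclideanSpace ℝ (Fin d)), t < b₀ * |inner ℝ n x| →
          (∀ i k, Viscoelastic.BromwichConverges σ
            (fun p => Viscoelastic.planeWaveIntegrand ρ G n t (inner ℝ n x) p i k)) ∧
          (∀ i k, ContDiffAt ℝ ∞
            (fun y : ℝ => Viscoelastic.G₂ ρ G n σ t y i k) (inner ℝ n x)) ∧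
          Viscoelastic.G₁ ρ G n σ t (inner ℝ n x) = 0) ∧
        (∀ t y : ℝ, Viscoelastic.G₁ ρ G n σ t y ≠ 0 → |y| ≤ (1 / b₀) * t) := by
  obtain ⟨c, hc, hQ⟩ := hG.exists_coercive_Qn hn
  obtain ⟨B, hB, hlim⟩ := hG.exists_tendsto_inv_smul_Kn hρ hn hc hQ
  obtain ⟨b₀, hleast, hb₀, hle⟩ := exists_pos_le_dotProduct hB (nonempty_of_norm_eq_one hn)
  have hBsymm : B.IsSymm := by
    have := hB.isHermitian
    rwa [Matrix.IsHermitian, Matrix.conjTranspose_eq_transpose_of_trivial] at this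
  have hK : ∀ p : ℂ, 0 < p.re → Coercive (b₀ * p.re) (Kn ρ G n p) := fun p hp =>
    hG.coercive_Kn hc hQ hBsymm hlim hb₀ hle hp
  refine ⟨B, b₀, hlim, hB, hleast, hb₀, fun σ hσ => ?_⟩
  -- `G₂(t, ·)` vanishes on the open set `t < b₀ |y|`
  have hzero : ∀ t y : ℝ, t < b₀ * |y| → ∀ i k,
      (fun z : ℝ => G₂ ρ G n σ t z i k) =ᶠ[𝓝 y] fun _ => 0 := fun t y hty i k => by
    have hopen : IsOpen {z : ℝ | t < b₀ * |z|} := isOpen_lt (by fun_prop) (by fun_prop)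
    filter_upwards [hopen.mem_nhds hty] with z hz
    have h1 := (hG.planeWave_bromwich hρ hc hQ hK hz hσ i k).2.limUnder_eq
    simp only [G₂, Matrix.of_apply, bromwichIntegral, h1, mul_zero]
  have hG₁ : ∀ t y : ℝ, t < b₀ * |y| → G₁ ρ G n σ t y = 0 := fun t y hty => by
    ext i k
    rw [G₁, Matrix.of_apply, (hzero t y hty i k).iteratedDeriv_eq, iteratedDeriv_const]
    simp
  refine ⟨fun t x htx => ⟨fun i k => ?_, fun i k => ?_, hG₁ t _ htx⟩, fun t y hne => ?_⟩
  · have h1 := hG.planeWave_bromwich hρ hc hQ hK htx hσ i k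
    exact ⟨h1.1, 0, h1.2⟩
  · exact contDiffAt_const.congr_of_eventuallyEq (hzero t _ htx i k)
  · by_contra h
    refine hne (hG₁ t y ?_)
    rw [not_le, one_div, inv_mul_lt_iff₀ hb₀] at h
    exact h
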